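/- Let $J=[-1,1]$ and, for $n\in\mathbb N$, let $\mathscr G^{2n}_n(\mathbb C)$ be the Grassmannian of $n$-dimensional subspaces of $\mathbb C^{2n}$ with its usual topology, given for instance by the gap metric $d(X,Y)=\|P_X-P_Y\|$, where $P_X$ is the orthogonal projection onto $X$. For every $n\in\mathbb N$ there is a constant $c=c(n)>0$ such that the following holds. Let $c^>,c^<:J\to\mathbb R$ be functions with $c^>(\tau)+c^<(\tau)>0$ for all $\tau\in J$, and let $A,R:J\to \mathrm{GL}_{2n}(\mathbb C)$ be smooth ($C^\infty$ on $J$, one-sided at the end points) such that for all $\tau\in J$ $$R(\tau)^{-1}A(\tau)R(\tau)=\begin{pmatrix}A^>(\tau)&0\\0&A^<(\tau)\end{pmatrix},\qquad A^>(\tau),A^<(\tau)\in\mathbb C^{n\times n},$$ and for all $\tau\in J$ and all $\eta\in\mathbb C^n$ $$\mathrm{Re}\langle\eta,A^>(\tau)\eta\rangle\ge c^>(\tau)|\eta|^2,\qquad \mathrm{Re}\langle\eta,A^>(\tau)^T\eta\rangle\ge c^>(\tau)|\eta|^2,$$ $$\mathrm{Re}\langle\eta,A^<(\tau)\eta\rangle\le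 -c^<(\tau)|\eta|^2,\qquad \mathrm{Re}\langle\eta,A^<(\tau)^T\eta\rangle\le -c^<(\tau)|\eta|^2,$$ where $T$ is the transpose without complex conjugation. Let $h:J\to(0,\infty)$ be smooth and let $\chi:\mathbb R\to(-1,1)$ be the solution of $\chi'=(1-\chi^2)h(\chi)$, $\chi(0)=0$. Let $U(\tau)$ and $S(\tau)$ be the subspaces spanned by the first $n$ and by the last $n$ columns of $R(\tau)$, respectively. A map $X:\mathbb R\to\mathscr G^{2n}_n(\mathbb C)$ is called a Grassmannian solution of the linear system $\xi'=A(\chi)\xi$ if there are $n$ solutions $\xi_1,\dots,\xi_n:\mathbb R\to\mathbb C^{2n}$ of this system with $X(x)=\mathrm{span}\{\xi_1(x),\dots,\xi_n(x)\}$ for all $x\in\mathbb R$. Then there is exactly one Grassmannian solution $X^-$ with $X^-(x)\to U(-1)$ as $x\to-\infty$, and exactly one Grassmannian solution $X^+$ with $X^+(x)\to S(+1)$ as $x\to+\infty$. If moreover $$\left|R(0)^{-1}\frac{dR}{d\tau}(\tau)\right|\le c\qquad\text{for all }\tau\in J$$ (operator norm for the Euclidean norm), then $$\lim_{x\to+\infty}X^-(x)=U(+1)\qquad\text{and}\qquad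 \lim_{x\to-\infty}X^+(x)=S(-1).$$ -/

import Mathlib

open Set Filter Topology
open scoped ContDiff Matrix Matrix.Norms.L2Operator MatrixGroups

noncomputable section

/-- The Grassmannian of `m`-dimensional subspaces of `ℂ^ι`. -/
def Grass (ι : Type) [Fintype ι] (m : ℕ) : Type :=
  {X : Submodule ℂ (EuclideanSpace ℂ ι) // Module.finrank ℂ X = m}

/-- The orthogonal projection of `ℂ^ι` onto the subspace `X`. -/
def Grass.proj {ι : Type} [Fintype ι] {m : ℕ} (X : Grass ι m) :
    EuclideanSpace ℂ ι →L[ℂ] EuclideanSpace ℂ ι :=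
  X.1.starProjection

theorem Grass.proj_injective {ι : Type} [Fintype ι] {m : ℕ} :
    Function.Injective (Grass.proj : Grass ι m → _) :=
  fun _ _ h => Subtype.ext (Submodule.starProjection_inj.1 h)

/-- The gap metric `d(X, Y) = ‖P_X - P_Y‖`, with `P_X` the orthogonal projection onto `X`; it
induces the usual topology of the Grassmannian. -/
instance Grass.metricSpace (ι : Type) [Fintype ι] (m : ℕ) : MetricSpace (Grass ι m) :=
  MetricSpace.induced Grass.proj Grass.proj_injective inferInstance

/-- The `k`-th column of a matrix, as a vector of `ℂ^ι`. -/
def colVec {ι κ : Type} (P : Matrix ι κ ℂ) (k : κ) : EuclideanSpace ℂ ι :=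
  WithLp.toLp 2 (P.col k)

theorem linearIndependent_colVec {ι : Type} [Fintype ι] [DecidableEq ι] (P : GL ι ℂ) :
    LinearIndependent ℂ (colVec (P : Matrix ι ι ℂ)) :=
  (Matrix.linearIndependent_cols_of_isUnit P.isUnit).map'
    (WithLp.linearEquiv 2 ℂ (ι → ℂ)).symm.toLinearMap (LinearEquiv.ker _)

/-- The subspace spanned by the columns of an invertible matrix whose indices lie in the image of the
injection `f`. -/
def spanCols {ι : Type} [Fintype ι] [DecidableEq ι] {m : ℕ} (P : GL ι ℂ) (f : Fin m ↪ ι) :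
    Grass ι m :=
  ⟨Submodule.span ℂ (range (colVec (P : Matrix ι ι ℂ) ∘ f)), by
    have h := finrank_span_eq_card ((linearIndependent_colVec P).comp f f.injective)
    rwa [Fintype.card_fin] at h⟩

/-- The subspace of `ℂ^{2n}` spanned by the first `n` columns of an invertible matrix. -/
def spanFirst {n : ℕ} (P : GL (Fin n ⊕ Fin n) ℂ) : Grass (Fin n ⊕ Fin n) n :=
  spanCols P ⟨Sum.inl, Sum.inl_injective⟩

/-- The subspace of `ℂ^{2n}` spanned by the last `n` columns of an invertible matrix. -/
def spanLast {n : ℕ} (P : GL (Fin n ⊕ Fin n) ℂ) : Grass (Fin n ⊕ Fin n) n :=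
  spanCols P ⟨Sum.inr, Sum.inr_injective⟩

/-- `X : ℝ → Grass ι m` solves the Grassmannian equation `X' = Γ^m(B(x)) X` associated with the
linear system `ξ' = B(x) ξ`: there are `m` solutions of the linear system whose values at each `x`
span `X x` (they are then linearly independent at each `x`, since `X x` has dimension `m`). -/
def IsGrassSolution {ι : Type} [Fintype ι] [DecidableEq ι] {m : ℕ}
    (B : ℝ → Matrix ι ι ℂ) (X : ℝ → Grass ι m) : Prop :=
  ∃ ξ : Fin m → ℝ → EuclideanSpace ℂ ι,
    (∀ j x, HasDerivAt (ξ j) (Matrix.toEuclideanLin (B x) (ξ j x)) x) ∧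
      ∀ x, (X x).1 = Submodule.span ℂ (range fun j => ξ j x)

/-- The matrix functions `A` and `R` with the block-diagonalization and the definiteness bounds. Functions on `J = [-1, 1]` are
given as functions on `ℝ` of which only the restrictions to `J` are used; in particular smoothness
is smoothness on `J` (one-sided at the end points). -/
structure BlockData {n : ℕ} (cgt clt : ℝ → ℝ) (A R : ℝ → GL (Fin n ⊕ Fin n) ℂ)
    (Agt Alt : ℝ → Matrix (Fin n) (Fin n) ℂ) : Prop where
  smooth_A : ContDiffOn ℝ ∞ (fun τ => (A τ : Matrix (Fin n ⊕ Fin n) (Fin n ⊕ Fin n) ℂ))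
    (Icc (-1) 1)
  smooth_R : ContDiffOn ℝ ∞ (fun τ => (R τ : Matrix (Fin n ⊕ Fin n) (Fin n ⊕ Fin n) ℂ))
    (Icc (-1) 1)
  pos : ∀ τ ∈ Icc (-1 : ℝ) 1, 0 < cgt τ + clt τ
  block : ∀ τ ∈ Icc (-1 : ℝ) 1,
    (((R τ)⁻¹ * A τ * R τ : GL (Fin n ⊕ Fin n) ℂ) : Matrix (Fin n ⊕ Fin n) (Fin n ⊕ Fin n) ℂ) =
      Matrix.fromBlocks (Agt τ) 0 0 (Alt τ)
  gt : ∀ τ ∈ Icc (-1 : ℝ) 1, ∀ η : EuclideanSpace ℂ (Fin n),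
    cgt τ * ‖η‖ ^ 2 ≤ (inner ℂ η (Matrix.toEuclideanLin (Agt τ) η)).re
  gt_transpose : ∀ τ ∈ Icc (-1 : ℝ) 1, ∀ η : EuclideanSpace ℂ (Fin n),
    cgt τ * ‖η‖ ^ 2 ≤ (inner ℂ η (Matrix.toEuclideanLin (Agt τ)ᵀ η)).re
  lt : ∀ τ ∈ Icc (-1 : ℝ) 1, ∀ η : EuclideanSpace ℂ (Fin n),
    (inner ℂ η (Matrix.toEuclideanLin (Alt τ) η)).re ≤ -clt τ * ‖η‖ ^ 2
  lt_transpose : ∀ τ ∈ Icc (-1 : ℝ) 1, ∀ η : EuclideanSpace ℂ (Fin n),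
    (inner ℂ η (Matrix.toEuclideanLin (Alt τ)ᵀ η)).re ≤ -clt τ * ‖η‖ ^ 2

end

/- In the moving frame formed by the columns of `R(χ)`, the two coordinates `U ξ` and `V ξ` of a
solution `ξ` have separated growth rates, up to a coupling of size `‖R⁻¹ R'‖ χ'`. A cone
`‖V ξ‖ ≤ r ‖U ξ‖` is therefore invariant as soon as its opening satisfies the Riccati inequality
`r' + (gap) r > (coupling) (1 + r)²`; dropping the gap, this is solved by `r = θ / (1 - θ)`, where
`θ` is the coupling accumulated since `-∞`. Compactness of the Grassmannian yields a space of
solutions in this cone, which is `X⁻`; it is the only one, because the difference of two solutions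
in the cone with the same coordinate `U` lies outside the cone, where solutions grow more slowly.

If `‖R(0)⁻¹ R'‖ ≤ 1/5`, then `‖R⁻¹ R'‖ ≤ 1/4`, so `θ` stays below `1/2` and the opening of the cone
below `1` on the whole line; as the coupling dies out at `+∞`, the gap then forces the opening to
`0`. The reflection `x ↦ -x` exchanges the roles of `U` and `V` and gives the claims on `X⁺`. -/

section LinearODE

variable {W : Type*} [NormedAddCommGroup W] [NormedSpace ℝ W]

theorem eq_of_forall_hasDerivAt_zero {f : ℝ → W} (hf : ∀ x, HasDerivAt f 0 x) (x y : ℝ) :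
    f x = f y :=
  is_const_of_deriv_eq_zero (fun x => (hf x).differentiableAt) (fun x => (hf x).deriv) x y

theorem norm_le_mul_exp_of_norm_deriv_le_of_nonneg {f f' : ℝ → W} {K T : ℝ}
    (hf : ∀ t ∈ Icc (-T) T, HasDerivWithinAt f (f' t) (Icc (-T) T) t)
    (hK : ∀ t ∈ Icc (-T) T, ‖f' t‖ ≤ K * ‖f t‖) {t : ℝ} (ht : t ∈ Icc 0 T) :
    ‖f t‖ ≤ ‖f 0‖ * Real.exp (K * t) := by
  have hsub : Icc 0 T ⊆ Icc (-T) T := Icc_subset_Icc (by linarith [ht.1, ht.2]) le_rfl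
  have hgronwall := norm_le_gronwallBound_of_norm_deriv_right_le (δ := ‖f 0‖) (K := K) (ε := 0)
    (fun s hs => (hf s (hsub hs)).continuousWithinAt.mono hsub)
    (fun s hs => (hf s (hsub (Ico_subset_Icc_self hs))).mono_of_mem_nhdsWithin
      (mem_of_superset (Icc_mem_nhdsGE hs.2) (Icc_subset_Icc (by linarith [hs.1, hs.2]) le_rfl)))
    le_rfl (fun s hs => by simpa using hK s (hsub (Ico_subset_Icc_self hs))) t ht
  simpa [gronwallBound_ε0] using hgronwall

theorem norm_le_mul_exp_of_norm_deriv_le {f f' : ℝ → W} {K T : ℝ}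
    (hf : ∀ t ∈ Icc (-T) T, HasDerivWithinAt f (f' t) (Icc (-T) T) t)
    (hK : ∀ t ∈ Icc (-T) T, ‖f' t‖ ≤ K * ‖f t‖) {t : ℝ} (ht : t ∈ Icc (-T) T) :
    ‖f t‖ ≤ ‖f 0‖ * Real.exp (K * |t|) := by
  have hneg : MapsTo Neg.neg (Icc (-T) T) (Icc (-T) T) := fun s hs =>
    ⟨by linarith [hs.2], by linarith [hs.1]⟩
  rcases le_total 0 t with h0 | h0
  · rw [abs_of_nonneg h0]
    exact norm_le_mul_exp_of_norm_deriv_le_of_nonneg hf hK ⟨h0, ht.2⟩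
  · have hf_neg : ∀ s ∈ Icc (-T) T,
        HasDerivWithinAt (fun s => f (-s)) (-f' (-s)) (Icc (-T) T) s := fun s hs => by
      simpa [Function.comp_def] using
        (hf (-s) (hneg hs)).scomp s (hasDerivAt_neg s).hasDerivWithinAt hneg
    simpa [abs_of_nonpos h0] using norm_le_mul_exp_of_norm_deriv_le_of_nonneg hf_neg
      (fun s hs => by simpa using hK _ (hneg hs)) (t := -t) ⟨by linarith, by linarith [ht.1]⟩

variable {G : ℝ → W →L[ℝ] W}

theorem linearODE_solution_unique_of_mem_Ioo (hG : Continuous G) {α β : ℝ → W} {T : ℝ}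
    (hα : ∀ t ∈ Ioo (-T) T, HasDerivAt α (G t (α t)) t)
    (hβ : ∀ t ∈ Ioo (-T) T, HasDerivAt β (G t (β t)) t) (h0 : α 0 = β 0) :
    EqOn α β (Ioo (-T) T) := by
  intro t ht
  have hT : 0 < T := by linarith [ht.1, ht.2]
  obtain ⟨K, hK⟩ := isCompact_Icc.exists_bound_of_continuousOn (s := Icc (-T) T) hG.continuousOn
  exact ODE_solution_unique_of_mem_Ioo (v := fun t w => G t w) (s := fun _ => univ)
    (K := K.toNNReal) (t₀ := 0)
    (fun t ht => ((G t).lipschitz.weaken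
      (NNReal.le_toNNReal_of_coe_le (hK t (Ioo_subset_Icc_self ht)))).lipschitzOnWith)
    ⟨by linarith, hT⟩ (fun t ht => ⟨hα t ht, trivial⟩) (fun t ht => ⟨hβ t ht, trivial⟩) h0 ht

variable [FiniteDimensional ℝ W]

theorem exists_lipschitzWith_bounded_eqOn_closedBall (r : ℝ) :
    ∃ (g : W → W) (C : NNReal) (M : ℝ), LipschitzWith C g ∧ (∀ w, ‖g w‖ ≤ M) ∧
      (∀ w, ‖g w‖ ≤ ‖w‖) ∧ EqOn g id (Metric.closedBall 0 r) := by
  let φ : ContDiffBump (0 : W) := ⟨|r| + 1, |r| + 2, by positivity, by linarith⟩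
  have hsupp : HasCompactSupport fun w => φ w • w := φ.hasCompactSupport.smul_right
  have hsmooth : ContDiff ℝ 1 fun w => φ w • w := φ.contDiff.smul contDiff_id
  obtain ⟨C, hC⟩ := hsmooth.lipschitzWith_of_hasCompactSupport hsupp one_ne_zero
  obtain ⟨M, hM⟩ := hsupp.exists_bound_of_continuous hsmooth.continuous
  refine ⟨fun w => φ w • w, C, M, hC, hM, fun w => ?_, fun w hw => ?_⟩
  · rw [norm_smul, Real.norm_of_nonneg φ.nonneg]
    exact mul_le_of_le_one_left (norm_nonneg _) φ.le_one
  · have hmem : w ∈ Metric.closedBall 0 φ.rIn :=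
      Metric.closedBall_subset_closedBall (by change r ≤ |r| + 1; linarith [le_abs_self r]) hw
    simp only [φ.one_of_mem_closedBall hmem, one_smul, id]

/- The Picard–Lindelöf theorem is applied to the equation cut off outside a large ball, which the
solutions do not leave by the a priori bound. -/
theorem exists_linearODE_solution_Icc (hG : Continuous G) (w₀ : W) {T : ℝ} (hT : 0 ≤ T) :
    ∃ α : ℝ → W, α 0 = w₀ ∧
      ∀ t ∈ Icc (-T) T, HasDerivWithinAt α (G t (α t)) (Icc (-T) T) t := by
  obtain ⟨K, hK⟩ := isCompact_Icc.exists_bound_of_continuousOn (s := Icc (-T) T) hG.continuousOn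
  have hK0 : 0 ≤ K := (norm_nonneg _).trans (hK 0 ⟨by linarith, hT⟩)
  obtain ⟨g, C, M, hlip, hbound, hle, hid⟩ :=
    exists_lipschitzWith_bounded_eqOn_closedBall (W := W) (‖w₀‖ * Real.exp (K * T))
  have hM0 : 0 ≤ M := (norm_nonneg _).trans (hbound 0)
  have hPL : IsPicardLindelof (fun t w => G t (g w)) (tmin := -T) (tmax := T)
      ⟨0, by linarith, hT⟩ w₀ (⟨K * M, by positivity⟩ * ⟨T, hT⟩) 0 ⟨K * M, by positivity⟩
      (⟨K, hK0⟩ * C) := by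
    refine ⟨fun t ht => ?_, fun w _ => (hG.clm_apply continuous_const).continuousOn,
      fun t ht w _ => ?_, ?_⟩
    · exact (((G t).lipschitz.weaken (by exact_mod_cast hK t ht)).comp hlip).lipschitzOnWith
    · exact ((G t).le_opNorm _).trans (mul_le_mul (hK t ht) (hbound w) (norm_nonneg _) hK0)
    · simp only [sub_zero, zero_sub, neg_neg, max_self, NNReal.coe_zero]
      exact le_rfl
  obtain ⟨α, hα0, hα⟩ := hPL.exists_eq_forall_mem_Icc_hasDerivWithinAt₀
  replace hα0 : α 0 = w₀ := hα0
  refine ⟨α, hα0, fun t ht => ?_⟩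
  have hmem : α t ∈ Metric.closedBall 0 (‖w₀‖ * Real.exp (K * T)) := by
    have hapriori := norm_le_mul_exp_of_norm_deriv_le hα (fun s hs => ((G s).le_opNorm _).trans
      (mul_le_mul (hK s hs) (hle _) (norm_nonneg _) hK0)) ht
    rw [mem_closedBall_zero_iff, ← hα0]
    refine hapriori.trans ?_
    gcongr
    exact abs_le.2 ht
  simpa only [hid hmem, id] using hα t ht

theorem exists_linearODE_solution (hG : Continuous G) (w₀ : W) :
    ∃ α : ℝ → W, α 0 = w₀ ∧ ∀ t, HasDerivAt α (G t (α t)) t := by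
  choose α h0 hα using fun N : ℕ => exists_linearODE_solution_Icc hG w₀ (Nat.cast_nonneg (α := ℝ) N)
  have hderiv (N : ℕ) : ∀ t ∈ Ioo (-(N : ℝ)) N, HasDerivAt (α N) (G t (α N t)) t :=
    fun t ht => (hα N t (Ioo_subset_Icc_self ht)).hasDerivAt (Icc_mem_nhds ht.1 ht.2)
  have hext {N M : ℕ} (hNM : N ≤ M) : EqOn (α N) (α M) (Ioo (-(N : ℝ)) N) := by
    have hNM' : (N : ℝ) ≤ M := by exact_mod_cast hNM
    exact linearODE_solution_unique_of_mem_Ioo hG (hderiv N)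
      (fun t ht => hderiv M t ⟨by linarith [ht.1], by linarith [ht.2]⟩) ((h0 N).trans (h0 M).symm)
  let ν : ℝ → ℕ := fun t => ⌈|t|⌉₊ + 1
  have hν (t : ℝ) : t ∈ Ioo (-(ν t : ℝ)) (ν t) := by
    refine abs_lt.1 ((Nat.le_ceil |t|).trans_lt ?_)
    simp only [ν, Nat.cast_add, Nat.cast_one, lt_add_iff_pos_right, zero_lt_one]
  refine ⟨fun t => α (ν t) t, h0 _, fun t => ?_⟩
  refine (hderiv _ t (hν t)).congr_of_eventuallyEq ?_
  filter_upwards [Ioo_mem_nhds (hν t).1 (hν t).2] with s hs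
  rcases le_total (ν t) (ν s) with h | h
  · exact (hext h hs).symm
  · exact hext h (hν s)

end LinearODE

section FundamentalSolution

variable {E F : Type*} [NormedAddCommGroup E] [NormedSpace ℂ E] [NormedAddCommGroup F]
  [NormedSpace ℂ F]

/-- `Φ` is a fundamental solution of the linear system `ξ' = B(x) ξ` on `ℝ`: the solutions are
exactly the curves `x ↦ Φ(x) e`, for constant vectors `e`. -/
structure IsFundamentalSolution (B : ℝ → E →L[ℂ] E) (Φ : ℝ → E ≃L[ℂ] E) : Prop where
  hasDerivAt : ∀ e x, HasDerivAt (fun x => Φ x e) (B x (Φ x e)) x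
  exists_eq : ∀ ξ : ℝ → E, (∀ x, HasDerivAt ξ (B x (ξ x)) x) → ∃ e, ∀ x, ξ x = Φ x e

theorem hasDerivAt_clm_apply_complex {f : ℝ → E →L[ℂ] F} {f' : E →L[ℂ] F} {g : ℝ → E} {g' : E}
    {x : ℝ} (hf : HasDerivAt f f' x) (hg : HasDerivAt g g' x) :
    HasDerivAt (fun x => f x (g x)) (f' (g x) + f x g') x := by
  have hf_real : HasDerivAt (fun x => (f x).restrictScalars ℝ) (f'.restrictScalars ℝ) x :=
    (ContinuousLinearMap.restrictScalarsL ℂ E F ℝ ℝ).hasFDerivAt.comp_hasDerivAt x hf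
  exact hf_real.clm_apply hg

/- If `Φ' = B Φ` and `Ψ' = -Ψ B` with `Φ(0) = Ψ(0) = 1`, then `Ψ Φ` is constant, and so is `Ψ ξ` for
every solution `ξ`. -/
theorem exists_isFundamentalSolution [FiniteDimensional ℂ E] {B : ℝ → E →L[ℂ] E}
    (hB : Continuous B) : ∃ Φ, IsFundamentalSolution B Φ := by
  have : FiniteDimensional ℝ (E →L[ℂ] E) := FiniteDimensional.complexToReal _
  let mul := ContinuousLinearMap.mul ℝ (E →L[ℂ] E)
  obtain ⟨Φ, hΦ0, hΦ⟩ := exists_linearODE_solution (mul.continuous.comp hB) 1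
  obtain ⟨Ψ, hΨ0, hΨ⟩ := exists_linearODE_solution (mul.flip.continuous.comp hB).neg 1
  replace hΦ : ∀ x, HasDerivAt Φ (B x * Φ x) x := fun x => by simpa [mul] using hΦ x
  replace hΨ : ∀ x, HasDerivAt Ψ (-(Ψ x * B x)) x := fun x => by simpa [mul] using hΨ x
  have hΨΦ : ∀ x, Ψ x * Φ x = 1 := fun x => by
    have hconst : ∀ x, HasDerivAt (fun x => Ψ x * Φ x) 0 x := fun x => by
      simpa only [neg_mul, mul_assoc, neg_add_cancel] using! (hΨ x).mul (hΦ x)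
    simpa [hΦ0, hΨ0] using eq_of_forall_hasDerivAt_zero hconst x 0
  have hΦΨ : ∀ x, Φ x * Ψ x = 1 := fun x => by
    have hlin : (Ψ x : E →ₗ[ℂ] E) * (Φ x : E →ₗ[ℂ] E) = 1 :=
      congrArg (fun f : E →L[ℂ] E => (f : E →ₗ[ℂ] E)) (hΨΦ x)
    exact ContinuousLinearMap.coe_injective (mul_eq_one_comm.1 hlin)
  refine ⟨fun x => ContinuousLinearEquiv.equivOfInverse (Φ x) (Ψ x)
    (DFunLike.congr_fun (hΨΦ x)) (DFunLike.congr_fun (hΦΨ x)), fun e x => ?_,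
    fun ξ hξ => ⟨ξ 0, fun x => ?_⟩⟩
  · simpa only [map_zero, add_zero] using!
      hasDerivAt_clm_apply_complex (hΦ x) (hasDerivAt_const x e)
  · have hconst : ∀ x, HasDerivAt (fun x => Ψ x (ξ x)) 0 x := fun x => by
      simpa using hasDerivAt_clm_apply_complex (hΨ x) (hξ x)
    have hΨξ : Ψ x (ξ x) = ξ 0 := by
      simpa only [hΨ0, one_apply_eq_self] using eq_of_forall_hasDerivAt_zero hconst x 0
    calc ξ x = Φ x (Ψ x (ξ x)) := (DFunLike.congr_fun (hΦΨ x) (ξ x)).symm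
      _ = Φ x (ξ 0) := by rw [hΨξ]

end FundamentalSolution

section Gap

variable {𝕜 E F G α : Type*} [RCLike 𝕜] [NormedAddCommGroup E] [InnerProductSpace 𝕜 E]

theorem norm_sub_starProjection_le (Y : Submodule 𝕜 E) [Y.HasOrthogonalProjection] (v : E) {y : E}
    (hy : y ∈ Y) : ‖v - Y.starProjection v‖ ≤ ‖v - y‖ := by
  rw [Y.starProjection_minimal v]
  exact ciInf_le ⟨0, forall_mem_range.2 fun _ => norm_nonneg _⟩ (⟨y, hy⟩ : Y)

theorem norm_starProjection_sub_starProjection_le [CompleteSpace E] (X Y : Submodule 𝕜 E)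
    [X.HasOrthogonalProjection] [Y.HasOrthogonalProjection] {s t : ℝ} (hs : 0 ≤ s) (ht : 0 ≤ t)
    (hXY : ∀ ξ ∈ X, ∃ y ∈ Y, ‖ξ - y‖ ≤ s * ‖ξ‖) (hYX : ∀ y ∈ Y, ∃ ξ ∈ X, ‖y - ξ‖ ≤ t * ‖y‖) :
    ‖X.starProjection - Y.starProjection‖ ≤ s + t := by
  have hcomp (Z Z' : Submodule 𝕜 E) [Z.HasOrthogonalProjection] [Z'.HasOrthogonalProjection] {r : ℝ}
      (hr : 0 ≤ r) (hZ : ∀ z ∈ Z, ∃ z' ∈ Z', ‖z - z'‖ ≤ r * ‖z‖) :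
      ‖(1 - Z'.starProjection) * Z.starProjection‖ ≤ r := by
    refine ContinuousLinearMap.opNorm_le_bound _ hr fun v => ?_
    obtain ⟨z', hz', hle⟩ := hZ _ (Z.starProjection_apply_mem v)
    calc ‖Z.starProjection v - Z'.starProjection (Z.starProjection v)‖
        ≤ ‖Z.starProjection v - z'‖ := norm_sub_starProjection_le Z' _ hz'
      _ ≤ r * ‖Z.starProjection v‖ := hle
      _ ≤ r * ‖v‖ := by gcongr; exact Z.norm_starProjection_apply_le v
  have hstar : star ((1 - X.starProjection) * Y.starProjection) =
      Y.starProjection * (1 - X.starProjection) := by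
    simp only [star_mul, star_sub, star_one, (isSelfAdjoint_starProjection _).star_eq]
  calc ‖X.starProjection - Y.starProjection‖
      = ‖(1 - Y.starProjection) * X.starProjection
          - star ((1 - X.starProjection) * Y.starProjection)‖ := by rw [hstar]; noncomm_ring
    _ ≤ s + t := (norm_sub_le _ _).trans
        (add_le_add (hcomp X Y hs hXY) ((norm_star _).trans_le (hcomp Y X ht hYX)))

variable [FiniteDimensional 𝕜 E]

theorem exists_norm_sub_le_of_finrank_eq {X Y : Submodule 𝕜 E}
    (hdim : Module.finrank 𝕜 X = Module.finrank 𝕜 Y) {s : ℝ} (hs0 : 0 ≤ s) (hs : s ≤ 1 / 2)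
    (hXY : ∀ ξ ∈ X, ∃ y ∈ Y, ‖ξ - y‖ ≤ s * ‖ξ‖) :
    ∀ y ∈ Y, ∃ ξ ∈ X, ‖y - ξ‖ ≤ 2 * s * ‖y‖ := by
  have hdist : ∀ ξ ∈ X, ‖ξ - Y.starProjection ξ‖ ≤ s * ‖ξ‖ := fun ξ hξ => by
    obtain ⟨y, hy, hle⟩ := hXY ξ hξ
    exact (norm_sub_starProjection_le Y ξ hy).trans hle
  have hlower : ∀ ξ ∈ X, ‖ξ‖ ≤ 2 * ‖Y.starProjection ξ‖ := fun ξ hξ => by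
    nlinarith [hdist ξ hξ, norm_le_norm_sub_add ξ (Y.starProjection ξ), norm_nonneg ξ]
  let p : X →ₗ[𝕜] Y := Y.orthogonalProjectionOnto.toLinearMap.domRestrict X
  have hinj : Function.Injective p := (injective_iff_map_eq_zero p).2 fun ξ hξ => by
    have hzero : Y.starProjection (ξ : E) = 0 := congrArg Subtype.val hξ
    simpa [hzero] using hlower ξ ξ.2
  intro y hy
  obtain ⟨ξ, hξ⟩ := (LinearMap.injective_iff_surjective_of_finrank_eq_finrank hdim).1 hinj ⟨y, hy⟩
  have hξy : Y.starProjection (ξ : E) = y := congrArg Subtype.val hξ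
  refine ⟨ξ, ξ.2, ?_⟩
  calc ‖y - ξ‖ = ‖(ξ : E) - y‖ := norm_sub_rev _ _
    _ ≤ s * ‖(ξ : E)‖ := hξy ▸ hdist ξ ξ.2
    _ ≤ s * (2 * ‖y‖) := by gcongr; exact hξy ▸ hlower ξ ξ.2
    _ = 2 * s * ‖y‖ := by ring

theorem norm_starProjection_sub_starProjection_le_of_finrank_eq {X Y : Submodule 𝕜 E}
    (hdim : Module.finrank 𝕜 X = Module.finrank 𝕜 Y) {s : ℝ} (hs0 : 0 ≤ s) (hs : s ≤ 1 / 2)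
    (hXY : ∀ ξ ∈ X, ∃ y ∈ Y, ‖ξ - y‖ ≤ s * ‖ξ‖) :
    ‖X.starProjection - Y.starProjection‖ ≤ 3 * s := by
  have := FiniteDimensional.complete 𝕜 E
  linarith [norm_starProjection_sub_starProjection_le X Y hs0 (by positivity) hXY
    (exists_norm_sub_le_of_finrank_eq hdim hs0 hs hXY)]

theorem tendsto_starProjection_of_eventually {l : Filter α} {X : α → Submodule 𝕜 E}
    {Y : Submodule 𝕜 E} (hdim : ∀ x, Module.finrank 𝕜 (X x) = Module.finrank 𝕜 Y)
    (h : ∀ s > 0, ∀ᶠ x in l, ∀ ξ ∈ X x, ∃ y ∈ Y, ‖ξ - y‖ ≤ s * ‖ξ‖) :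
    Tendsto (fun x => (X x).starProjection) l (𝓝 Y.starProjection) := by
  refine Metric.tendsto_nhds.2 fun e he => ?_
  filter_upwards [h (min (e / 4) (1 / 2)) (by positivity)] with x hx
  rw [dist_eq_norm]
  linarith [norm_starProjection_sub_starProjection_le_of_finrank_eq (hdim x) (by positivity)
    (min_le_right _ _) hx, min_le_left (e / 4) (1 / 2)]

theorem exists_subseq_tendsto_submodule {X : ℕ → Submodule 𝕜 E} {m : ℕ}
    (hX : ∀ N, Module.finrank 𝕜 (X N) = m) :
    ∃ (Y : Submodule 𝕜 E) (φ : ℕ → ℕ), Module.finrank 𝕜 Y = m ∧ StrictMono φ ∧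
      ∀ y ∈ Y, ∃ f : ℕ → E, (∀ N, f N ∈ X (φ N)) ∧ Tendsto f atTop (𝓝 y) := by
  have := FiniteDimensional.proper 𝕜 E
  let b (N : ℕ) : OrthonormalBasis (Fin m) 𝕜 (X N) :=
    (stdOrthonormalBasis 𝕜 (X N)).reindex (finCongr (hX N))
  let f (N : ℕ) (j : Fin m) : E := b N j
  have hf (N : ℕ) : Orthonormal 𝕜 (f N) := (b N).orthonormal.comp_linearIsometry (X N).subtypeₗᵢ
  have hcompact : IsCompact (univ.pi fun _ : Fin m => Metric.closedBall (0 : E) 1) :=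
    isCompact_univ_pi fun _ => isCompact_closedBall _ _
  obtain ⟨g, -, φ, hφ, hg⟩ := hcompact.tendsto_subseq (x := f) fun N j _ => by
    simp only [mem_closedBall_zero_iff, (hf N).1 j, le_refl]
  have hg_apply (j : Fin m) : Tendsto (fun N => f (φ N) j) atTop (𝓝 (g j)) := tendsto_pi_nhds.1 hg j
  have hg_orthonormal : Orthonormal 𝕜 g := orthonormal_iff_ite.2 fun i j => by
    refine tendsto_nhds_unique ((hg_apply i).inner (hg_apply j)) ?_
    simpa only [orthonormal_iff_ite.1 (hf _) i j] using tendsto_const_nhds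
  refine ⟨Submodule.span 𝕜 (range g), φ, ?_, hφ, fun y hy => ?_⟩
  · simpa using finrank_span_eq_card hg_orthonormal.linearIndependent
  · obtain ⟨c, rfl⟩ := (Submodule.mem_span_range_iff_exists_fun 𝕜).1 hy
    exact ⟨fun N => ∑ j, c j • f (φ N) j,
      fun N => Submodule.sum_mem _ fun j _ => Submodule.smul_mem _ _ (b (φ N) j).2,
      tendsto_finsetSum _ fun j _ => (hg_apply j).const_smul (c j)⟩

variable [NormedAddCommGroup F] [NormedSpace 𝕜 F]
  [NormedAddCommGroup G] [NormedSpace 𝕜 G]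

variable {l : Filter α} {U : α → E →L[𝕜] F} {V : α → E →L[𝕜] G} {V₀ : E →L[𝕜] G}
  {C : ℝ} {X : α → Submodule 𝕜 E}

theorem eventually_cone_of_tendsto_starProjection_ker (hV : Tendsto V l (𝓝 V₀))
    (hC : ∀ x ξ, ‖ξ‖ ≤ C * (‖U x ξ‖ + ‖V x ξ‖))
    (h : Tendsto (fun x => (X x).starProjection) l
      (𝓝 (LinearMap.ker V₀.toLinearMap).starProjection)) {e : ℝ} (he : 0 < e) :
    ∀ᶠ x in l, ∀ ξ ∈ X x, ‖V x ξ‖ ≤ e * ‖U x ξ‖ := by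
  have hzero : V₀ ∘L (LinearMap.ker V₀.toLinearMap).starProjection = 0 := by
    ext ξ
    exact (LinearMap.ker V₀.toLinearMap).starProjection_apply_mem ξ
  have hVP : Tendsto (fun x => ‖V x ∘L (X x).starProjection‖) l (𝓝 0) := by
    simpa [Function.comp_def, hzero] using
      (((ContinuousLinearMap.compL 𝕜 E E G).continuous₂.tendsto _).comp (hV.prodMk_nhds h)).norm
  set d := min e 1 / (2 * (|C| + 1)) with hd
  have hd0 : 0 < d := by positivity
  filter_upwards [hVP.eventually_le_const hd0] with x hx ξ hξ
  have hVξ : ‖V x ξ‖ ≤ d * ‖ξ‖ := by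
    simpa [(X x).starProjection_eq_self_iff.2 hξ] using
      (V x ∘L (X x).starProjection).le_of_opNorm_le hx ξ
  have hcone : ‖V x ξ‖ ≤ min e 1 / 2 * (‖U x ξ‖ + ‖V x ξ‖) := calc
    ‖V x ξ‖ ≤ d * ((|C| + 1) * (‖U x ξ‖ + ‖V x ξ‖)) := by
      refine hVξ.trans (mul_le_mul_of_nonneg_left ((hC x ξ).trans ?_) hd0.le)
      gcongr
      linarith [le_abs_self C]
    _ = min e 1 / 2 * (‖U x ξ‖ + ‖V x ξ‖) := by rw [hd]; field_simp
  nlinarith [min_le_left e 1, min_le_right e 1, norm_nonneg (U x ξ), norm_nonneg (V x ξ)]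

variable [FiniteDimensional 𝕜 F] [FiniteDimensional 𝕜 G]

section Coordinates

variable {U : E →L[𝕜] F} {V : E →L[𝕜] G} {C : ℝ}

theorem exists_coordinates_eq
    (hdim : Module.finrank 𝕜 E = Module.finrank 𝕜 F + Module.finrank 𝕜 G)
    (hC : ∀ ξ, ‖ξ‖ ≤ C * (‖U ξ‖ + ‖V ξ‖)) (u : F) (v : G) : ∃ ξ, U ξ = u ∧ V ξ = v := by
  have hinj : Function.Injective (U.toLinearMap.prod V.toLinearMap) :=
    (injective_iff_map_eq_zero _).2 fun ξ hξ => by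
      have hU : U ξ = 0 := congrArg Prod.fst hξ
      have hV : V ξ = 0 := congrArg Prod.snd hξ
      simpa [hU, hV] using hC ξ
  obtain ⟨ξ, hξ⟩ := (LinearMap.injective_iff_surjective_of_finrank_eq_finrank
    (by rw [Module.finrank_prod, hdim])).1 hinj (u, v)
  exact ⟨ξ, congrArg Prod.fst hξ, congrArg Prod.snd hξ⟩

theorem finrank_ker_of_coordinates
    (hdim : Module.finrank 𝕜 E = Module.finrank 𝕜 F + Module.finrank 𝕜 G)
    (hC : ∀ ξ, ‖ξ‖ ≤ C * (‖U ξ‖ + ‖V ξ‖)) :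
    Module.finrank 𝕜 (LinearMap.ker V.toLinearMap) = Module.finrank 𝕜 F := by
  have hrange : LinearMap.range V.toLinearMap = ⊤ := LinearMap.range_eq_top.2 fun v =>
    (exists_coordinates_eq hdim hC 0 v).imp fun _ => And.right
  have hrank := V.toLinearMap.finrank_range_add_finrank_ker
  rw [hrange, finrank_top, hdim] at hrank
  omega

theorem exists_mem_ker_norm_sub_le
    (hdim : Module.finrank 𝕜 E = Module.finrank 𝕜 F + Module.finrank 𝕜 G)
    (hC : ∀ ξ, ‖ξ‖ ≤ C * (‖U ξ‖ + ‖V ξ‖)) (ξ : E) :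
    ∃ y ∈ LinearMap.ker V.toLinearMap, ‖ξ - y‖ ≤ C * ‖V ξ‖ := by
  obtain ⟨y, hUy, hVy⟩ := exists_coordinates_eq hdim hC (U ξ) 0
  exact ⟨y, hVy, by simpa [hUy, hVy] using hC (ξ - y)⟩

end Coordinates

theorem tendsto_starProjection_ker_of_eventually_cone
    (hdim : Module.finrank 𝕜 E = Module.finrank 𝕜 F + Module.finrank 𝕜 G)
    (hX : ∀ x, Module.finrank 𝕜 (X x) = Module.finrank 𝕜 F) {U₀ : E →L[𝕜] F}
    (hU : Tendsto U l (𝓝 U₀)) (hV : Tendsto V l (𝓝 V₀))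
    (hC₀ : ∀ ξ, ‖ξ‖ ≤ C * (‖U₀ ξ‖ + ‖V₀ ξ‖))
    (h : ∀ e > 0, ∀ᶠ x in l, ∀ ξ ∈ X x, ‖V x ξ‖ ≤ e * ‖U x ξ‖) :
    Tendsto (fun x => (X x).starProjection) l
      (𝓝 (LinearMap.ker V₀.toLinearMap).starProjection) := by
  refine tendsto_starProjection_of_eventually
    (fun x => (hX x).trans (finrank_ker_of_coordinates hdim hC₀).symm) fun s hs => ?_
  have hC : 0 < |C| + 1 := by positivity
  set e := s / (|C| + 1) with he
  have he0 : 0 < e := by positivity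
  filter_upwards [h (e / (2 * (‖U₀‖ + 1))) (by positivity),
    (tendsto_iff_norm_sub_tendsto_zero.1 hV).eventually_le_const (half_pos he0),
    hU.norm.eventually_le_const (lt_add_one ‖U₀‖)] with x hcone hVx hUx ξ hξ
  have hV₀ξ : ‖V₀ ξ‖ ≤ e * ‖ξ‖ := calc
    ‖V₀ ξ‖ ≤ ‖V x ξ‖ + ‖(V x - V₀) ξ‖ := by simpa using norm_sub_le (V x ξ) ((V x - V₀) ξ)
    _ ≤ e / (2 * (‖U₀‖ + 1)) * ((‖U₀‖ + 1) * ‖ξ‖) + e / 2 * ‖ξ‖ :=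
      add_le_add ((hcone ξ hξ).trans (by gcongr; exact (U x).le_of_opNorm_le hUx ξ))
        ((V x - V₀).le_of_opNorm_le hVx ξ)
    _ = e * ‖ξ‖ := by field_simp; ring
  obtain ⟨y, hy, hle⟩ := exists_mem_ker_norm_sub_le hdim hC₀ ξ
  refine ⟨y, hy, hle.trans ?_⟩
  calc C * ‖V₀ ξ‖ ≤ (|C| + 1) * (e * ‖ξ‖) :=
        mul_le_mul (by linarith [le_abs_self C]) hV₀ξ (norm_nonneg _) hC.le
    _ = s * ‖ξ‖ := by rw [he]; field_simp

end Gap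

section ScalarInequalities

theorem mul_exp_le_of_mul_le_deriv {f f' : ℝ → ℝ} {c x y : ℝ} (hxy : x ≤ y)
    (hf : ∀ t ∈ Icc x y, HasDerivAt f (f' t) t) (hc : ∀ t ∈ Icc x y, c * f t ≤ f' t) :
    f x * Real.exp (c * (y - x)) ≤ f y := by
  have hderiv : ∀ t ∈ Icc x y, HasDerivAt (fun t => f t * Real.exp (-(c * t)))
      ((f' t - c * f t) * Real.exp (-(c * t))) t := fun t ht =>
    ((hf t ht).fun_mul ((hasDerivAt_id t).const_mul c).fun_neg.exp).congr_deriv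
      (by simp only [id]; ring)
  have hmono : MonotoneOn (fun t => f t * Real.exp (-(c * t))) (Icc x y) :=
    monotoneOn_of_hasDerivWithinAt_nonneg (convex_Icc x y)
      (fun t ht => (hderiv t ht).continuousAt.continuousWithinAt)
      (fun t ht => (hderiv t (interior_subset ht)).hasDerivWithinAt)
      (fun t ht => mul_nonneg (sub_nonneg.2 (hc t (interior_subset ht))) (Real.exp_pos _).le)
  calc f x * Real.exp (c * (y - x))
      = f x * Real.exp (-(c * x)) * Real.exp (c * y) := by
        rw [mul_assoc, ← Real.exp_add]; ring_nf
    _ ≤ f y * Real.exp (-(c * y)) * Real.exp (c * y) := by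
        gcongr ?_ * _
        exact hmono (left_mem_Icc.2 hxy) (right_mem_Icc.2 hxy) hxy
    _ = f y := by rw [mul_assoc, ← Real.exp_add, neg_add_cancel, Real.exp_zero, mul_one]

theorem le_mul_exp_of_deriv_le_mul {f f' : ℝ → ℝ} {c x y : ℝ} (hxy : x ≤ y)
    (hf : ∀ t ∈ Icc x y, HasDerivAt f (f' t) t) (hc : ∀ t ∈ Icc x y, f' t ≤ c * f t) :
    f y ≤ f x * Real.exp (c * (y - x)) := by
  have hneg := mul_exp_le_of_mul_le_deriv (c := c) hxy (fun t ht => (hf t ht).neg)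
    (fun t ht => by rw [Pi.neg_apply]; linarith [hc t ht])
  simp only [Pi.neg_apply] at hneg
  linarith

end ScalarInequalities

section SeparatedGrowth

variable {F G : Type*} [NormedAddCommGroup F] [InnerProductSpace ℂ F]
  [NormedAddCommGroup G] [InnerProductSpace ℂ G]

/-- Growth condition for two vectors `u`, `v` moving with velocities `u'`, `v'`: up to a coupling of
size `ε`, the norm of `u` grows at least at rate `a` and that of `v` at most at rate `b`. -/
def SeparatedGrowth (u u' : F) (v v' : G) (ε a b : ℝ) : Prop :=
  a * ‖u‖ ^ 2 - ε * ‖u‖ * (‖u‖ + ‖v‖) ≤ (inner ℂ u u').re ∧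
    (inner ℂ v v').re ≤ b * ‖v‖ ^ 2 + ε * ‖v‖ * (‖u‖ + ‖v‖)

theorem SeparatedGrowth.reverse {u u' : F} {v v' : G} {ε a b : ℝ}
    (h : SeparatedGrowth u u' v v' ε a b) : SeparatedGrowth v (-v') u (-u') ε (-b) (-a) := by
  simp only [SeparatedGrowth, inner_neg_right, Complex.neg_re]
  constructor <;> linarith [h.1, h.2]

theorem SeparatedGrowth.deriv_lt_of_norm_eq {u u' : F} {v v' : G} {ε a b r r' : ℝ}
    (h : SeparatedGrowth u u' v v' ε a b) (hne : u ≠ 0 ∨ v ≠ 0) (hr : 0 < r)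
    (hvu : ‖v‖ = r * ‖u‖) (hriccati : ε * (1 + r) ^ 2 < r' + (a - b) * r) :
    2 * (inner ℂ v v').re < 2 * r * r' * ‖u‖ ^ 2 + r ^ 2 * (2 * (inner ℂ u u').re) := by
  have hu : 0 < ‖u‖ := norm_pos_iff.2 fun hu => hne.elim (· hu) fun hv =>
    hv (norm_eq_zero.1 (by rw [hvu, hu, norm_zero, mul_zero]))
  obtain ⟨hlower, hupper⟩ := h
  rw [hvu] at hlower hupper
  have hlower_mul := mul_le_mul_of_nonneg_left hlower (sq_nonneg r)
  have hgap : 0 < 2 * r * ‖u‖ ^ 2 * (r' + (a - b) * r - ε * (1 + r) ^ 2) :=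
    mul_pos (by positivity) (sub_pos.2 hriccati)
  linarith

theorem hasDerivAt_norm_sq {f : ℝ → F} {f' : F} {x : ℝ} (hf : HasDerivAt f f' x) :
    HasDerivAt (fun x => ‖f x‖ ^ 2) (2 * (inner ℂ (f x) f').re) x := by
  let : InnerProductSpace ℝ F := InnerProductSpace.rclikeToReal ℂ F
  exact hf.norm_sq

variable {u u' : ℝ → F} {v v' : ℝ → G} {x₀ x₁ : ℝ}

/- On the boundary of the cone `‖v‖ ≤ r ‖u‖`, the Riccati inequality for the opening `r` says that
`‖v‖² - r² ‖u‖²` is strictly decreasing. -/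
theorem norm_le_mul_norm_of_riccati (hu : ∀ x, HasDerivAt u (u' x) x)
    (hv : ∀ x, HasDerivAt v (v' x) x) (hne : ∀ x, u x ≠ 0 ∨ v x ≠ 0) {r r' : ℝ → ℝ} (h01 : x₀ ≤ x₁)
    (hr : ∀ x ∈ Icc x₀ x₁, HasDerivAt r (r' x) x) (hpos : ∀ x ∈ Icc x₀ x₁, 0 < r x)
    (hgrowth : ∀ x ∈ Icc x₀ x₁, ∃ ε a b, SeparatedGrowth (u x) (u' x) (v x) (v' x) ε a b ∧
      ε * (1 + r x) ^ 2 < r' x + (a - b) * r x)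
    (h0 : ‖v x₀‖ ≤ r x₀ * ‖u x₀‖) : ‖v x₁‖ ≤ r x₁ * ‖u x₁‖ := by
  have hderiv : ∀ x ∈ Icc x₀ x₁, HasDerivAt (fun x => ‖v x‖ ^ 2 - r x ^ 2 * ‖u x‖ ^ 2)
      (2 * (inner ℂ (v x) (v' x)).re -
        (2 * r x * r' x * ‖u x‖ ^ 2 + r x ^ 2 * (2 * (inner ℂ (u x) (u' x)).re))) x :=
    fun x hx => (hasDerivAt_norm_sq (hv x)).sub
      (((hr x hx).fun_pow 2).congr_deriv (by simp) |>.mul (hasDerivAt_norm_sq (hu x)))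
  have hcone_iff {x : ℝ} (hx : x ∈ Icc x₀ x₁) :
      ‖v x‖ ^ 2 - r x ^ 2 * ‖u x‖ ^ 2 ≤ 0 ↔ ‖v x‖ ≤ r x * ‖u x‖ := by
    rw [sub_nonpos, ← mul_pow]
    exact sq_le_sq₀ (norm_nonneg _) (mul_nonneg (hpos x hx).le (norm_nonneg _))
  refine (hcone_iff (right_mem_Icc.2 h01)).1 (image_le_of_deriv_right_lt_deriv_boundary'
    (B := fun _ => 0) (B' := fun _ => 0) (fun x hx => (hderiv x hx).continuousAt.continuousWithinAt)
    (fun x hx => (hderiv x (Ico_subset_Icc_self hx)).hasDerivWithinAt)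
    ((hcone_iff (left_mem_Icc.2 h01)).2 h0) continuousOn_const
    (fun x _ => hasDerivWithinAt_const x _ _) (fun x hx hx0 => ?_) (right_mem_Icc.2 h01))
  replace hx := Ico_subset_Icc_self hx
  obtain ⟨ε, a, b, hab, hriccati⟩ := hgrowth x hx
  have hvu : ‖v x‖ = r x * ‖u x‖ := by
    refine (pow_left_inj₀ (norm_nonneg _) (mul_nonneg (hpos x hx).le (norm_nonneg _))
      two_ne_zero).1 ?_
    rw [mul_pow]
    linarith
  linarith [hab.deriv_lt_of_norm_eq (hne x) (hpos x hx) hvu hriccati]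

theorem norm_le_mul_norm_of_eq_zero (hu : ∀ x, HasDerivAt u (u' x) x)
    (hv : ∀ x, HasDerivAt v (v' x) x) (hne : ∀ x, u x ≠ 0 ∨ v x ≠ 0) {θ θ' : ℝ → ℝ} (h01 : x₀ ≤ x₁)
    (hθ : ∀ x, HasDerivAt θ (θ' x) x) (hθ_mem : ∀ x ∈ Icc x₀ x₁, θ x ∈ Ioo 0 1)
    (hgrowth : ∀ x, ∃ a b, b < a ∧ SeparatedGrowth (u x) (u' x) (v x) (v' x) (θ' x) a b)
    (h0 : v x₀ = 0) : ‖v x₁‖ ≤ θ x₁ / (1 - θ x₁) * ‖u x₁‖ := by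
  have hpos : ∀ x ∈ Icc x₀ x₁, 0 < θ x / (1 - θ x) := fun x hx =>
    div_pos (hθ_mem x hx).1 (sub_pos.2 (hθ_mem x hx).2)
  refine norm_le_mul_norm_of_riccati hu hv hne (r := fun x => θ x / (1 - θ x))
    (r' := fun x => θ' x / (1 - θ x) ^ 2) h01 (fun x hx => ?_) hpos (fun x hx => ?_) ?_
  · exact ((hθ x).fun_div ((hθ x).const_sub 1) (sub_pos.2 (hθ_mem x hx).2).ne').congr_deriv
      (by ring)
  · obtain ⟨a, b, hab, hx_growth⟩ := hgrowth x
    refine ⟨θ' x, a, b, hx_growth, ?_⟩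
    have hsum : 1 + θ x / (1 - θ x) = 1 / (1 - θ x) := by
      have := (sub_pos.2 (hθ_mem x hx).2).ne'
      field_simp
      ring
    rw [hsum, div_pow, one_pow, mul_one_div]
    linarith [mul_pos (sub_pos.2 hab) (hpos x hx)]
  · rw [h0, norm_zero]
    exact mul_nonneg (hpos x₀ (left_mem_Icc.2 h01)).le (norm_nonneg _)

theorem norm_le_add_exp_mul_norm (hu : ∀ x, HasDerivAt u (u' x) x)
    (hv : ∀ x, HasDerivAt v (v' x) x) (hne : ∀ x, u x ≠ 0 ∨ v x ≠ 0) {ε : ℝ → ℝ} {a b q : ℝ}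
    (h01 : x₀ ≤ x₁) (hab : b < a) (hq0 : 0 < q) (hq1 : q ≤ 1)
    (hgrowth : ∀ x ∈ Icc x₀ x₁, SeparatedGrowth (u x) (u' x) (v x) (v' x) (ε x) a b)
    (hε : ∀ x ∈ Icc x₀ x₁, 9 * ε x < (a - b) * q) (h0 : ‖v x₀‖ ≤ ‖u x₀‖) :
    ‖v x₁‖ ≤ (q + Real.exp (-((a - b) / 2) * (x₁ - x₀))) * ‖u x₁‖ := by
  have hδ : 0 < a - b := sub_pos.2 hab
  let w : ℝ → ℝ := fun x => Real.exp (-((a - b) / 2) * (x - x₀))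
  refine norm_le_mul_norm_of_riccati hu hv hne (r := fun x => q + w x)
    (r' := fun x => w x * -((a - b) / 2)) h01 (fun x _ => ?_) (fun x _ => by positivity)
    (fun x hx => ⟨ε x, a, b, hgrowth x hx, ?_⟩) ?_
  · simpa [w] using (((hasDerivAt_id x).sub_const x₀).const_mul (-((a - b) / 2))).exp.const_add q
  · have hw0 : 0 < w x := Real.exp_pos _
    have hw1 : w x ≤ 1 := Real.exp_le_one_iff.2 (by nlinarith [hx.1])
    have hopening : (1 + (q + w x)) ^ 2 ≤ 9 := by nlinarith
    have hδw : 0 < (a - b) * w x := mul_pos hδ hw0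
    rcases le_total (ε x) 0 with hε0 | hε0
    · nlinarith [mul_pos hδ hq0, mul_nonneg (neg_nonneg.2 hε0) (sq_nonneg (1 + (q + w x)))]
    · linarith [mul_le_mul_of_nonneg_left hopening hε0, hε x hx]
  · simp only [w, sub_self, mul_zero, Real.exp_zero]
    nlinarith [norm_nonneg (u x₀)]

theorem norm_sq_mul_exp_le_of_norm_le (hu : ∀ x, HasDerivAt u (u' x) x) {ε : ℝ → ℝ} {a b δ : ℝ}
    (h01 : x₀ ≤ x₁) (hgrowth : ∀ x ∈ Icc x₀ x₁,
      SeparatedGrowth (u x) (u' x) (v x) (v' x) (ε x) a b ∧ ε x ∈ Icc 0 (δ / 2))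
    (hcone : ∀ x ∈ Icc x₀ x₁, ‖v x‖ ≤ ‖u x‖) :
    ‖u x₀‖ ^ 2 * Real.exp (2 * (a - δ) * (x₁ - x₀)) ≤ ‖u x₁‖ ^ 2 := by
  refine mul_exp_le_of_mul_le_deriv h01 (fun x _ => hasDerivAt_norm_sq (hu x)) fun x hx => ?_
  obtain ⟨⟨hlower, -⟩, hε0, hε⟩ := hgrowth x hx
  have hδ : 0 ≤ δ / 2 := hε0.trans hε
  have hcoupling : ε x * ‖u x‖ * (‖u x‖ + ‖v x‖) ≤ δ / 2 * ‖u x‖ * (‖u x‖ + ‖u x‖) := by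
    gcongr
    exact hcone x hx
  linarith

theorem norm_sq_le_mul_exp_of_norm_le (hv : ∀ x, HasDerivAt v (v' x) x) {ε : ℝ → ℝ} {a b δ : ℝ}
    (h01 : x₀ ≤ x₁) (hgrowth : ∀ x ∈ Icc x₀ x₁,
      SeparatedGrowth (u x) (u' x) (v x) (v' x) (ε x) a b ∧ ε x ∈ Icc 0 (δ / 2))
    (hcone : ∀ x ∈ Icc x₀ x₁, ‖u x‖ ≤ ‖v x‖) :
    ‖v x₁‖ ^ 2 ≤ ‖v x₀‖ ^ 2 * Real.exp (2 * (b + δ) * (x₁ - x₀)) := by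
  refine le_mul_exp_of_deriv_le_mul h01 (fun x _ => hasDerivAt_norm_sq (hv x)) fun x hx => ?_
  obtain ⟨⟨-, hupper⟩, hε0, hε⟩ := hgrowth x hx
  have hδ : 0 ≤ δ / 2 := hε0.trans hε
  have hcoupling : ε x * ‖v x‖ * (‖u x‖ + ‖v x‖) ≤ δ / 2 * ‖v x‖ * (‖v x‖ + ‖v x‖) := by
    gcongr
    exact hcone x hx
  linarith

end SeparatedGrowth

section SplitSystem

variable {E F G : Type*} [NormedAddCommGroup E] [InnerProductSpace ℂ E]
  [NormedAddCommGroup F] [InnerProductSpace ℂ F] [NormedAddCommGroup G] [InnerProductSpace ℂ G]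

/-- The coordinates `U ξ`, `V ξ` of the solutions of `ξ' = B ξ` satisfy `SeparatedGrowth` at the
point `x`. -/
def SeparatedGrowthAt (B : ℝ → E →L[ℂ] E) (U : ℝ → E →L[ℂ] F) (V : ℝ → E →L[ℂ] G) (x ε a b : ℝ) :
    Prop :=
  ∀ ξ : E, SeparatedGrowth (U x ξ) (deriv U x ξ + U x (B x ξ)) (V x ξ) (deriv V x ξ + V x (B x ξ))
    ε a b

theorem SeparatedGrowthAt.reverse {B : ℝ → E →L[ℂ] E} {U : ℝ → E →L[ℂ] F} {V : ℝ → E →L[ℂ] G}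
    {x ε a b : ℝ} (h : SeparatedGrowthAt B U V (-x) ε a b) :
    SeparatedGrowthAt (fun x => -B (-x)) (fun x => V (-x)) (fun x => U (-x)) x ε (-b) (-a) := by
  intro ξ
  simpa only [deriv_comp_neg, neg_apply, map_neg, neg_add] using (h ξ).reverse

variable (E F G) in
/-- A linear system `ξ' = B(x) ξ` on the line with coordinates `U(x) ξ`, `V(x) ξ` whose growth rates
are separated up to a coupling of size `θ'`, where the accumulated coupling `θ` increases from `0`
to `L`. -/
structure SplitSystem where
  B : ℝ → E →L[ℂ] E
  U : ℝ → E →L[ℂ] F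
  V : ℝ → E →L[ℂ] G
  θ : ℝ → ℝ
  L : ℝ
  finrank_eq : Module.finrank ℂ E = Module.finrank ℂ F + Module.finrank ℂ G
  continuous_B : Continuous B
  differentiable_U : Differentiable ℝ U
  differentiable_V : Differentiable ℝ V
  exists_norm_le : ∃ C, ∀ x ξ, ‖ξ‖ ≤ C * (‖U x ξ‖ + ‖V x ξ‖)
  differentiable_θ : Differentiable ℝ θ
  monotone_θ : Monotone θ
  θ_mem : ∀ x, θ x ∈ Ioo 0 L
  tendsto_θ_atBot : Tendsto θ atBot (𝓝 0)
  tendsto_θ_atTop : Tendsto θ atTop (𝓝 L)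
  tendsto_deriv_θ_atBot : Tendsto (deriv θ) atBot (𝓝 0)
  tendsto_deriv_θ_atTop : Tendsto (deriv θ) atTop (𝓝 0)
  growth : ∀ x, ∃ a b, b < a ∧ SeparatedGrowthAt B U V x (deriv θ x) a b
  growth_atBot : ∃ a b, b < a ∧ ∀ᶠ x in atBot, SeparatedGrowthAt B U V x (deriv θ x) a b
  growth_atTop : ∃ a b, b < a ∧ ∀ᶠ x in atTop, SeparatedGrowthAt B U V x (deriv θ x) a b

theorem deriv_const_sub_comp_neg (c : ℝ) (f : ℝ → ℝ) :
    deriv (fun x => c - f (-x)) = fun x => deriv f (-x) := by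
  funext x
  rw [deriv_const_sub, deriv_comp_neg, neg_neg]

/-- The system satisfied by `x ↦ ξ(-x)`, with the two coordinates exchanged. -/
def SplitSystem.reverse (S : SplitSystem E F G) : SplitSystem E G F where
  B x := -S.B (-x)
  U x := S.V (-x)
  V x := S.U (-x)
  θ x := S.L - S.θ (-x)
  L := S.L
  finrank_eq := S.finrank_eq.trans (add_comm _ _)
  continuous_B := (S.continuous_B.comp continuous_neg).neg
  differentiable_U := S.differentiable_V.comp differentiable_neg
  differentiable_V := S.differentiable_U.comp differentiable_neg
  exists_norm_le := S.exists_norm_le.imp fun C hC x ξ => (hC (-x) ξ).trans_eq (by rw [add_comm])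
  differentiable_θ := (S.differentiable_θ.comp differentiable_neg).const_sub S.L
  monotone_θ x y hxy := sub_le_sub_left (S.monotone_θ (neg_le_neg hxy)) S.L
  θ_mem x := ⟨sub_pos.2 (S.θ_mem (-x)).2, sub_lt_self _ (S.θ_mem (-x)).1⟩
  tendsto_θ_atBot := by
    simpa using (S.tendsto_θ_atTop.comp tendsto_neg_atBot_atTop).const_sub S.L
  tendsto_θ_atTop := by
    simpa using (S.tendsto_θ_atBot.comp tendsto_neg_atTop_atBot).const_sub S.L
  tendsto_deriv_θ_atBot := by
    rw [deriv_const_sub_comp_neg]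
    exact S.tendsto_deriv_θ_atTop.comp tendsto_neg_atBot_atTop
  tendsto_deriv_θ_atTop := by
    rw [deriv_const_sub_comp_neg]
    exact S.tendsto_deriv_θ_atBot.comp tendsto_neg_atTop_atBot
  growth x := by
    obtain ⟨a, b, hab, h⟩ := S.growth (-x)
    exact ⟨-b, -a, neg_lt_neg hab, by simpa only [deriv_const_sub_comp_neg] using h.reverse⟩
  growth_atBot := by
    obtain ⟨a, b, hab, h⟩ := S.growth_atTop
    exact ⟨-b, -a, neg_lt_neg hab, (tendsto_neg_atBot_atTop.eventually h).mono fun x hx => by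
      simpa only [deriv_const_sub_comp_neg] using hx.reverse⟩
  growth_atTop := by
    obtain ⟨a, b, hab, h⟩ := S.growth_atBot
    exact ⟨-b, -a, neg_lt_neg hab, (tendsto_neg_atTop_atBot.eventually h).mono fun x hx => by
      simpa only [deriv_const_sub_comp_neg] using hx.reverse⟩

namespace SplitSystem

variable {S : SplitSystem E F G}

theorem ne_zero_or_ne_zero (x : ℝ) {ξ : E} (hξ : ξ ≠ 0) : S.U x ξ ≠ 0 ∨ S.V x ξ ≠ 0 := by
  by_contra! h
  obtain ⟨C, hC⟩ := S.exists_norm_le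
  exact hξ (by simpa [h.1, h.2] using hC x ξ)

theorem deriv_θ_nonneg (x : ℝ) : 0 ≤ deriv S.θ x := S.monotone_θ.deriv_nonneg

theorem hasDerivAt_U_apply {ξ : ℝ → E} {x : ℝ} (hξ : HasDerivAt ξ (S.B x (ξ x)) x) :
    HasDerivAt (fun x => S.U x (ξ x)) (deriv S.U x (ξ x) + S.U x (S.B x (ξ x))) x :=
  hasDerivAt_clm_apply_complex (S.differentiable_U x).hasDerivAt hξ

theorem hasDerivAt_V_apply {ξ : ℝ → E} {x : ℝ} (hξ : HasDerivAt ξ (S.B x (ξ x)) x) :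
    HasDerivAt (fun x => S.V x (ξ x)) (deriv S.V x (ξ x) + S.V x (S.B x (ξ x))) x :=
  hasDerivAt_clm_apply_complex (S.differentiable_V x).hasDerivAt hξ

variable {Φ : ℝ → E ≃L[ℂ] E} {X Y : Submodule ℂ E}

/-- The cone condition satisfied by the initial values of the solutions that emanate from `ker V`
at `-∞`: their coordinates satisfy `‖V ξ‖ ≤ θ / (1 - θ) ‖U ξ‖` as long as `θ < 1`. -/
def InNarrowCone (S : SplitSystem E F G) (Φ : ℝ → E ≃L[ℂ] E) (X : Submodule ℂ E) : Prop :=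
  ∀ e ∈ X, ∀ x, S.θ x < 1 → ‖S.V x (Φ x e)‖ ≤ S.θ x / (1 - S.θ x) * ‖S.U x (Φ x e)‖

/- A limit, as `N → ∞`, of the subspaces of those initial values whose solutions lie in `ker V` at
the point `-N`. -/
theorem exists_inNarrowCone [FiniteDimensional ℂ E] [FiniteDimensional ℂ F] [FiniteDimensional ℂ G]
    (hΦ : IsFundamentalSolution S.B Φ) :
    ∃ X : Submodule ℂ E, Module.finrank ℂ X = Module.finrank ℂ F ∧ S.InNarrowCone Φ X := by
  obtain ⟨C, hC⟩ := S.exists_norm_le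
  let X (N : ℕ) : Submodule ℂ E :=
    (LinearMap.ker (S.V (-N)).toLinearMap).comap (Φ (-N) : E →ₗ[ℂ] E)
  have hX (N : ℕ) : Module.finrank ℂ (X N) = Module.finrank ℂ F := by
    rw [← finrank_ker_of_coordinates S.finrank_eq (hC (-N))]
    exact ((Φ (-N)).toLinearEquiv.ofSubmodule' _).finrank_eq
  have hcone {N : ℕ} {e : E} (he : e ∈ X N) {x : ℝ} (hNx : -(N : ℝ) ≤ x) (hx : S.θ x < 1) :
      ‖S.V x (Φ x e)‖ ≤ S.θ x / (1 - S.θ x) * ‖S.U x (Φ x e)‖ := by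
    rcases eq_or_ne e 0 with rfl | hne
    · simp only [map_zero, norm_zero, mul_zero, le_refl]
    · exact norm_le_mul_norm_of_eq_zero (fun x => S.hasDerivAt_U_apply (hΦ.hasDerivAt e x))
        (fun x => S.hasDerivAt_V_apply (hΦ.hasDerivAt e x))
        (fun x => S.ne_zero_or_ne_zero x ((Φ x).map_ne_zero_iff.2 hne)) hNx
        (fun x => (S.differentiable_θ x).hasDerivAt)
        (fun y hy => ⟨(S.θ_mem y).1, (S.monotone_θ hy.2).trans_lt hx⟩)
        (fun x => (S.growth x).imp fun a => Exists.imp fun b h => ⟨h.1, h.2 _⟩) he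
  obtain ⟨Y, φ, hY, hφ, hlim⟩ := exists_subseq_tendsto_submodule hX
  refine ⟨Y, hY, fun e he x hx => ?_⟩
  obtain ⟨f, hfX, hf⟩ := hlim e he
  have hV := ((S.V x ∘L (Φ x : E →L[ℂ] E)).continuous.tendsto e).comp hf |>.norm
  have hU := ((S.U x ∘L (Φ x : E →L[ℂ] E)).continuous.tendsto e).comp hf |>.norm
  refine le_of_tendsto_of_tendsto hV (hU.const_mul _) ?_
  have hφ_atTop : Tendsto (fun N => (φ N : ℝ)) atTop atTop :=
    tendsto_natCast_atTop_atTop.comp hφ.tendsto_atTop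
  filter_upwards [hφ_atTop.eventually_ge_atTop (-x)] with N hN
  exact hcone (hfX N) (by linarith) hx

theorem InNarrowCone.eventually_atBot (hX : S.InNarrowCone Φ X) {e : ℝ} (he : 0 < e) :
    ∀ᶠ x in atBot, ∀ ξ ∈ X, ‖S.V x (Φ x ξ)‖ ≤ e * ‖S.U x (Φ x ξ)‖ := by
  have hopening : Tendsto (fun x => S.θ x / (1 - S.θ x)) atBot (𝓝 0) := by
    simpa [Pi.div_def] using S.tendsto_θ_atBot.div (S.tendsto_θ_atBot.const_sub 1) (by norm_num)
  filter_upwards [hopening.eventually_le_const he,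
    S.tendsto_θ_atBot.eventually_lt_const one_pos] with x hx hx1 ξ hξ
  exact (hX ξ hξ x hx1).trans (by gcongr)

theorem InNarrowCone.norm_V_le_norm_U (hX : S.InNarrowCone Φ X) (hL : S.L ≤ 1 / 2) {ξ : E}
    (hξ : ξ ∈ X) (x : ℝ) : ‖S.V x (Φ x ξ)‖ ≤ ‖S.U x (Φ x ξ)‖ := by
  have hθ : S.θ x < 1 / 2 := (S.θ_mem x).2.trans_le hL
  refine (hX ξ hξ x (by linarith)).trans (mul_le_of_le_one_left (norm_nonneg _) ?_)
  exact (div_le_one (by linarith)).2 (by linarith)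

theorem InNarrowCone.eventually_atTop (hΦ : IsFundamentalSolution S.B Φ) (hL : S.L ≤ 1 / 2)
    (hX : S.InNarrowCone Φ X) {e : ℝ} (he : 0 < e) :
    ∀ᶠ x in atTop, ∀ ξ ∈ X, ‖S.V x (Φ x ξ)‖ ≤ e * ‖S.U x (Φ x ξ)‖ := by
  obtain ⟨a, b, hab, hgrowth⟩ := S.growth_atTop
  have hδ : 0 < a - b := sub_pos.2 hab
  set q := min (e / 2) 1
  have hq : 0 < q := by positivity
  have hθ : Tendsto (fun x => 9 * deriv S.θ x) atTop (𝓝 0) := by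
    simpa using S.tendsto_deriv_θ_atTop.const_mul 9
  obtain ⟨x₀, hx₀⟩ := Filter.eventually_atTop.1
    (hgrowth.and (hθ.eventually_lt_const (mul_pos hδ hq)))
  have hexp : Tendsto (fun x => Real.exp (-((a - b) / 2) * (x - x₀))) atTop (𝓝 0) :=
    Real.tendsto_exp_atBot.comp (Tendsto.const_mul_atTop_of_neg (by linarith)
      (tendsto_atTop_add_const_right _ _ tendsto_id))
  filter_upwards [eventually_ge_atTop x₀, hexp.eventually_le_const (half_pos he)] with x hx hxe ξ hξ
  rcases eq_or_ne ξ 0 with rfl | hne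
  · simp only [map_zero, norm_zero, mul_zero, le_refl]
  · refine (norm_le_add_exp_mul_norm (fun x => S.hasDerivAt_U_apply (hΦ.hasDerivAt ξ x))
      (fun x => S.hasDerivAt_V_apply (hΦ.hasDerivAt ξ x))
      (fun x => S.ne_zero_or_ne_zero x ((Φ x).map_ne_zero_iff.2 hne)) hx hab hq (min_le_right _ _)
      (fun y hy => (hx₀ y hy.1).1 _) (fun y hy => (hx₀ y hy.1).2)
      (hX.norm_V_le_norm_U hL hξ x₀)).trans ?_
    gcongr
    linarith [min_le_left (e / 2) 1]

theorem exists_mem_U_eq [FiniteDimensional ℂ E] [FiniteDimensional ℂ F]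
    (hX : Module.finrank ℂ X = Module.finrank ℂ F) {x : ℝ}
    (hcone : ∀ ξ ∈ X, ‖S.V x (Φ x ξ)‖ ≤ ‖S.U x (Φ x ξ)‖) (u : F) :
    ∃ e ∈ X, S.U x (Φ x e) = u := by
  let p : X →ₗ[ℂ] F := (S.U x ∘L (Φ x : E →L[ℂ] E)).toLinearMap.domRestrict X
  have hinj : Function.Injective p := (injective_iff_map_eq_zero p).2 fun e he => by
    have hU : S.U x (Φ x e) = 0 := he
    have hV : S.V x (Φ x e) = 0 := norm_le_zero_iff.1 (by simpa [hU] using hcone e e.2)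
    by_contra hne
    have hΦe : Φ x e ≠ 0 := (Φ x).map_ne_zero_iff.2 fun h => hne (Subtype.ext h)
    exact (S.ne_zero_or_ne_zero x hΦe).elim (· hU) (· hV)
  obtain ⟨e, he⟩ := (LinearMap.injective_iff_surjective_of_finrank_eq_finrank hX).1 hinj u
  exact ⟨e, e.2, he⟩

section Uniqueness

variable {T a b : ℝ}

theorem norm_U_le_norm_V_of_U_eq_zero (hΦ : IsFundamentalSolution S.B Φ) (hab : b < a)
    (hgap : ∀ x ≤ T, SeparatedGrowthAt S.B S.U S.V x (deriv S.θ x) a b ∧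
      deriv S.θ x ∈ Icc 0 ((a - b) / 4 / 2)) {z : E} (hz : S.U T (Φ T z) = 0) {x : ℝ} (hx : x ≤ T) :
    ‖S.U x (Φ x z)‖ ≤ ‖S.V x (Φ x z)‖ := by
  by_contra! hlt
  have hz0 : z ≠ 0 := by rintro rfl; simp at hlt
  have hne (x : ℝ) : S.U x (Φ x z) ≠ 0 ∨ S.V x (Φ x z) ≠ 0 :=
    S.ne_zero_or_ne_zero x ((Φ x).map_ne_zero_iff.2 hz0)
  have hcone : ‖S.V T (Φ T z)‖ ≤ 1 * ‖S.U T (Φ T z)‖ :=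
    norm_le_mul_norm_of_riccati (fun x => S.hasDerivAt_U_apply (hΦ.hasDerivAt z x))
      (fun x => S.hasDerivAt_V_apply (hΦ.hasDerivAt z x)) hne (r' := 0) hx
      (fun x _ => hasDerivAt_const x 1) (fun _ _ => one_pos)
      (fun y hy => ⟨deriv S.θ y, a, b, (hgap y hy.2).1 _, by
        rw [Pi.zero_apply]
        linarith [(hgap y hy.2).2.2]⟩) (by rw [one_mul]; exact hlt.le)
  rw [hz, norm_zero, mul_zero] at hcone
  exact (hne T).elim (· hz) (· (norm_le_zero_iff.1 hcone))

/- The difference `y - e` stays outside the cone on `Iic T`, hence grows at most at rate `b`,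
whereas `y` and `e` grow at least at rate `a`. -/
theorem norm_V_sub_sq_le_mul_exp (hΦ : IsFundamentalSolution S.B Φ) (hab : b < a)
    (hgap : ∀ x ≤ T, SeparatedGrowthAt S.B S.U S.V x (deriv S.θ x) a b ∧
      deriv S.θ x ∈ Icc 0 ((a - b) / 4 / 2)) {y e : E}
    (hy : ∀ x ≤ T, ‖S.V x (Φ x y)‖ ≤ ‖S.U x (Φ x y)‖)
    (he : ∀ x ≤ T, ‖S.V x (Φ x e)‖ ≤ ‖S.U x (Φ x e)‖)
    (hU : S.U T (Φ T e) = S.U T (Φ T y)) {x : ℝ} (hx : x ≤ T) :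
    ‖S.V T (Φ T (y - e))‖ ^ 2 ≤ 4 * ‖S.U T (Φ T y)‖ ^ 2 * Real.exp (-((a - b) * (T - x))) := by
  have hz : S.U T (Φ T (y - e)) = 0 := by rw [map_sub, map_sub, hU, sub_self]
  have hgrow {w : E} (hw : ∀ x ≤ T, ‖S.V x (Φ x w)‖ ≤ ‖S.U x (Φ x w)‖) :
      ‖S.U x (Φ x w)‖ ^ 2 * Real.exp (2 * (a - (a - b) / 4) * (T - x)) ≤ ‖S.U T (Φ T w)‖ ^ 2 :=
    norm_sq_mul_exp_le_of_norm_le (fun x => S.hasDerivAt_U_apply (hΦ.hasDerivAt w x)) hx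
      (fun t ht => ⟨(hgap t ht.2).1 _, (hgap t ht.2).2⟩) fun t ht => hw t ht.2
  have hsub : ‖S.V x (Φ x (y - e))‖ ^ 2 ≤ 2 * (‖S.U x (Φ x y)‖ ^ 2 + ‖S.U x (Φ x e)‖ ^ 2) := by
    rw [map_sub, map_sub]
    calc ‖S.V x (Φ x y) - S.V x (Φ x e)‖ ^ 2
        ≤ (‖S.U x (Φ x y)‖ + ‖S.U x (Φ x e)‖) ^ 2 := by
          gcongr
          exact (norm_sub_le _ _).trans (add_le_add (hy x hx) (he x hx))
      _ ≤ _ := add_sq_le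
  have hexp : Real.exp (2 * (b + (a - b) / 4) * (T - x)) =
      Real.exp (2 * (a - (a - b) / 4) * (T - x)) * Real.exp (-((a - b) * (T - x))) := by
    rw [← Real.exp_add]
    ring_nf
  calc ‖S.V T (Φ T (y - e))‖ ^ 2
      ≤ ‖S.V x (Φ x (y - e))‖ ^ 2 * Real.exp (2 * (b + (a - b) / 4) * (T - x)) :=
        norm_sq_le_mul_exp_of_norm_le (fun x => S.hasDerivAt_V_apply (hΦ.hasDerivAt _ x)) hx
          (fun t ht => ⟨(hgap t ht.2).1 _, (hgap t ht.2).2⟩)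
          fun t ht => norm_U_le_norm_V_of_U_eq_zero hΦ hab hgap hz ht.2
    _ ≤ 2 * (‖S.U x (Φ x y)‖ ^ 2 + ‖S.U x (Φ x e)‖ ^ 2) *
          Real.exp (2 * (b + (a - b) / 4) * (T - x)) := by gcongr
    _ = 2 * (‖S.U x (Φ x y)‖ ^ 2 * Real.exp (2 * (a - (a - b) / 4) * (T - x)) +
          ‖S.U x (Φ x e)‖ ^ 2 * Real.exp (2 * (a - (a - b) / 4) * (T - x))) *
          Real.exp (-((a - b) * (T - x))) := by rw [hexp]; ring
    _ ≤ 2 * (‖S.U T (Φ T y)‖ ^ 2 + ‖S.U T (Φ T e)‖ ^ 2) * Real.exp (-((a - b) * (T - x))) := by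
        gcongr
        exacts [hgrow hy, hgrow he]
    _ = 4 * ‖S.U T (Φ T y)‖ ^ 2 * Real.exp (-((a - b) * (T - x))) := by rw [hU]; ring

theorem eq_of_U_eq (hΦ : IsFundamentalSolution S.B Φ) (hab : b < a)
    (hgap : ∀ x ≤ T, SeparatedGrowthAt S.B S.U S.V x (deriv S.θ x) a b ∧
      deriv S.θ x ∈ Icc 0 ((a - b) / 4 / 2)) {y e : E}
    (hy : ∀ x ≤ T, ‖S.V x (Φ x y)‖ ≤ ‖S.U x (Φ x y)‖)
    (he : ∀ x ≤ T, ‖S.V x (Φ x e)‖ ≤ ‖S.U x (Φ x e)‖)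
    (hU : S.U T (Φ T e) = S.U T (Φ T y)) : y = e := by
  have hlim : Tendsto (fun x => 4 * ‖S.U T (Φ T y)‖ ^ 2 * Real.exp (-((a - b) * (T - x)))) atBot
      (𝓝 0) := by
    have hsub : Tendsto (fun x => T - x) atBot atTop :=
      tendsto_atTop_add_const_left _ T tendsto_neg_atBot_atTop
    simpa using (Real.tendsto_exp_neg_atTop_nhds_zero.comp
      (hsub.const_mul_atTop (sub_pos.2 hab))).const_mul (4 * ‖S.U T (Φ T y)‖ ^ 2)
  have hV_sq : ‖S.V T (Φ T (y - e))‖ ^ 2 ≤ 0 := ge_of_tendsto hlim <|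
    (eventually_le_atBot T).mono fun x hx => norm_V_sub_sq_le_mul_exp hΦ hab hgap hy he hU hx
  have hV : S.V T (Φ T (y - e)) = 0 := by simpa using hV_sq.antisymm (sq_nonneg _)
  have hU_sub : S.U T (Φ T (y - e)) = 0 := by rw [map_sub, map_sub, hU, sub_self]
  by_contra hne
  exact (S.ne_zero_or_ne_zero T ((Φ T).map_ne_zero_iff.2 (sub_ne_zero.2 hne))).elim
    (· hU_sub) (· hV)

theorem eq_of_eventually_norm_V_le_norm_U [FiniteDimensional ℂ E] [FiniteDimensional ℂ F]
    (hΦ : IsFundamentalSolution S.B Φ) (hX : Module.finrank ℂ X = Module.finrank ℂ F)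
    (hY : Module.finrank ℂ Y = Module.finrank ℂ F)
    (hXc : ∀ᶠ x in atBot, ∀ ξ ∈ X, ‖S.V x (Φ x ξ)‖ ≤ ‖S.U x (Φ x ξ)‖)
    (hYc : ∀ᶠ x in atBot, ∀ ξ ∈ Y, ‖S.V x (Φ x ξ)‖ ≤ ‖S.U x (Φ x ξ)‖) : X = Y := by
  obtain ⟨a, b, hab, hgrowth⟩ := S.growth_atBot
  have hθ : ∀ᶠ x in atBot, deriv S.θ x ≤ (a - b) / 4 / 2 :=
    S.tendsto_deriv_θ_atBot.eventually_le_const (by linarith)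
  obtain ⟨T, hT⟩ := Filter.eventually_atBot.1 ((hXc.and hYc).and (hgrowth.and hθ))
  refine (Submodule.eq_of_le_of_finrank_eq (fun y hy => ?_) (hY.trans hX.symm)).symm
  obtain ⟨e, he, hU⟩ := exists_mem_U_eq hX (hT T le_rfl).1.1 (S.U T (Φ T y))
  have hye : y = e := eq_of_U_eq hΦ hab
    (fun x hx => ⟨(hT x hx).2.1, S.deriv_θ_nonneg x, (hT x hx).2.2⟩)
    (fun x hx => (hT x hx).1.2 y hy) (fun x hx => (hT x hx).1.1 e he) hU
  exact hye ▸ he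

theorem InNarrowCone.eq [FiniteDimensional ℂ E] [FiniteDimensional ℂ F]
    (hΦ : IsFundamentalSolution S.B Φ) (hXF : Module.finrank ℂ X = Module.finrank ℂ F)
    (hYF : Module.finrank ℂ Y = Module.finrank ℂ F) (hX : S.InNarrowCone Φ X)
    (hY : S.InNarrowCone Φ Y) : X = Y :=
  eq_of_eventually_norm_V_le_norm_U hΦ hXF hYF (by simpa using hX.eventually_atBot one_pos)
    (by simpa using hY.eventually_atBot one_pos)

end Uniqueness

end SplitSystem

end SplitSystem

section GrassSolution

variable {ι : Type} [Fintype ι] {m : ℕ} {X : ℝ → Grass ι m} {Y Z : Grass ι m}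
  {Φ : ℝ → EuclideanSpace ℂ ι ≃L[ℂ] EuclideanSpace ℂ ι} {X₀ : Submodule ℂ (EuclideanSpace ℂ ι)}

theorem Grass.tendsto_iff {l : Filter ℝ} :
    Tendsto X l (𝓝 Y) ↔ Tendsto (fun x => (X x).1.starProjection) l (𝓝 Y.1.starProjection) :=
  (IsInducing.mk rfl : IsInducing (Grass.proj : Grass ι m → _)).tendsto_nhds_iff

section IsGrassSolution

variable [DecidableEq ι] {M : ℝ → Matrix ι ι ℂ}

theorem IsGrassSolution.reverse (hX : IsGrassSolution M X) :
    IsGrassSolution (fun x => -M (-x)) (fun x => X (-x)) := by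
  obtain ⟨ξ, hξ, hspan⟩ := hX
  refine ⟨fun j x => ξ j (-x), fun j x => ?_, fun x => hspan (-x)⟩
  simpa [Function.comp_def] using (hξ j (-x)).scomp x (hasDerivAt_neg x)

theorem IsGrassSolution.exists_eq_map (hX : IsGrassSolution M X)
    (hΦ : IsFundamentalSolution (fun x => Matrix.toEuclideanCLM (𝕜 := ℂ) (M x)) Φ) :
    ∃ X₀ : Submodule ℂ (EuclideanSpace ℂ ι), Module.finrank ℂ X₀ = m ∧
      ∀ x, (X x).1 = X₀.map (Φ x).toLinearMap := by
  obtain ⟨ξ, hξ, hspan⟩ := hX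
  choose e he using fun j => hΦ.exists_eq (ξ j) (hξ j)
  have hmap (x : ℝ) : (X x).1 = (Submodule.span ℂ (range e)).map (Φ x).toLinearMap := by
    rw [hspan x, Submodule.map_span, ← range_comp]
    exact congrArg _ (congrArg range (funext fun j => he j x))
  have hfinrank := (X 0).2
  rw [hmap 0] at hfinrank
  exact ⟨_, (LinearEquiv.finrank_map_eq (Φ 0).toLinearEquiv _).symm.trans hfinrank, hmap⟩

theorem isGrassSolution_of_eq_map
    (hΦ : IsFundamentalSolution (fun x => Matrix.toEuclideanCLM (𝕜 := ℂ) (M x)) Φ)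
    (hX₀ : Module.finrank ℂ X₀ = m) (hX : ∀ x, (X x).1 = X₀.map (Φ x).toLinearMap) :
    IsGrassSolution M X := by
  let b := Module.finBasisOfFinrankEq ℂ X₀ hX₀
  have hb : Submodule.span ℂ (range fun j => (b j : EuclideanSpace ℂ ι)) = X₀ := by
    have hspan := congrArg (Submodule.map X₀.subtype) b.span_eq
    rwa [Submodule.map_span, ← range_comp, Submodule.map_subtype_top] at hspan
  refine ⟨fun j x => Φ x (b j), fun j x => hΦ.hasDerivAt _ x, fun x => ?_⟩
  calc (X x).1 = (Submodule.span ℂ (range fun j => (b j : EuclideanSpace ℂ ι))).map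
        (Φ x).toLinearMap := by rw [hX x, hb]
    _ = Submodule.span ℂ (range fun j => Φ x (b j)) := by
        rw [Submodule.map_span, ← range_comp]
        rfl

end IsGrassSolution

namespace SplitSystem

variable {F G : Type*} [NormedAddCommGroup F] [InnerProductSpace ℂ F]
  [NormedAddCommGroup G] [InnerProductSpace ℂ G]
  {S : SplitSystem (EuclideanSpace ℂ ι) F G} {U₀ U₁ : EuclideanSpace ℂ ι →L[ℂ] F}
  {V₀ V₁ : EuclideanSpace ℂ ι →L[ℂ] G}

theorem reverse_B [DecidableEq ι] {M : ℝ → Matrix ι ι ℂ}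
    (hB : S.B = fun x => Matrix.toEuclideanCLM (𝕜 := ℂ) (M x)) :
    S.reverse.B = fun x => Matrix.toEuclideanCLM (𝕜 := ℂ) (-M (-x)) := by
  funext x
  simp only [SplitSystem.reverse, hB, map_neg]

variable [FiniteDimensional ℂ F] [FiniteDimensional ℂ G]

theorem tendsto_grass_of_eventually_cone {l : Filter ℝ} [l.NeBot] (hm : Module.finrank ℂ F = m)
    (hX : ∀ x, (X x).1 = X₀.map (Φ x).toLinearMap) (hU : Tendsto S.U l (𝓝 U₀))
    (hV : Tendsto S.V l (𝓝 V₀)) (hY : Y.1 = LinearMap.ker V₀.toLinearMap)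
    (hcone : ∀ e > 0, ∀ᶠ x in l, ∀ ξ ∈ X₀, ‖S.V x (Φ x ξ)‖ ≤ e * ‖S.U x (Φ x ξ)‖) :
    Tendsto X l (𝓝 Y) := by
  obtain ⟨C, hC⟩ := S.exists_norm_le
  have hC₀ (ξ : EuclideanSpace ℂ ι) : ‖ξ‖ ≤ C * (‖U₀ ξ‖ + ‖V₀ ξ‖) := by
    have hUξ := ((ContinuousLinearMap.apply ℂ F ξ).continuous.tendsto U₀).comp hU
    have hVξ := ((ContinuousLinearMap.apply ℂ G ξ).continuous.tendsto V₀).comp hV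
    exact ge_of_tendsto' ((hUξ.norm.add hVξ.norm).const_mul C) fun x => hC x ξ
  rw [Grass.tendsto_iff, hY]
  refine tendsto_starProjection_ker_of_eventually_cone S.finrank_eq
    (fun x => (X x).2.trans hm.symm) hU hV hC₀ fun e he => ?_
  filter_upwards [hcone e he] with x hx ξ hξ
  rw [hX x] at hξ
  obtain ⟨ξ, hξ, rfl⟩ := hξ
  exact hx ξ hξ

theorem inNarrowCone_of_tendsto_atBot (hΦ : IsFundamentalSolution S.B Φ)
    (hX₀ : Module.finrank ℂ X₀ = Module.finrank ℂ F)
    (hX : ∀ x, (X x).1 = X₀.map (Φ x).toLinearMap) (hV : Tendsto S.V atBot (𝓝 V₀))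
    (hY : Y.1 = LinearMap.ker V₀.toLinearMap) (hlim : Tendsto X atBot (𝓝 Y)) :
    S.InNarrowCone Φ X₀ := by
  obtain ⟨C, hC⟩ := S.exists_norm_le
  obtain ⟨X₁, hX₁, hnarrow⟩ := exists_inNarrowCone hΦ
  rw [Grass.tendsto_iff, hY] at hlim
  have hcone : ∀ᶠ x in atBot, ∀ ξ ∈ X₀, ‖S.V x (Φ x ξ)‖ ≤ ‖S.U x (Φ x ξ)‖ := by
    filter_upwards [eventually_cone_of_tendsto_starProjection_ker hV hC hlim one_pos] with x hx ξ hξ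
    rw [← one_mul ‖S.U x (Φ x ξ)‖]
    exact hx (Φ x ξ) (by rw [hX x]; exact Submodule.mem_map_of_mem hξ)
  have hX₀X₁ : X₀ = X₁ := eq_of_eventually_norm_V_le_norm_U hΦ hX₀ hX₁ hcone
    (by simpa using hnarrow.eventually_atBot one_pos)
  exact hX₀X₁ ▸ hnarrow

variable [DecidableEq ι] {M : ℝ → Matrix ι ι ℂ}

theorem existsUnique_isGrassSolution_tendsto_atBot
    (hB : S.B = fun x => Matrix.toEuclideanCLM (𝕜 := ℂ) (M x)) (hm : Module.finrank ℂ F = m)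
    (hU : Tendsto S.U atBot (𝓝 U₀)) (hV : Tendsto S.V atBot (𝓝 V₀))
    (hY : Y.1 = LinearMap.ker V₀.toLinearMap) :
    ∃! X : ℝ → Grass ι m, IsGrassSolution M X ∧ Tendsto X atBot (𝓝 Y) := by
  obtain ⟨Φ, hΦ⟩ := exists_isFundamentalSolution S.continuous_B
  obtain ⟨X₀, hX₀, hnarrow⟩ := exists_inNarrowCone hΦ
  let X (x : ℝ) : Grass ι m := ⟨X₀.map (Φ x).toLinearMap,
    (LinearEquiv.finrank_map_eq (Φ x).toLinearEquiv X₀).trans (hX₀.trans hm)⟩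
  refine ⟨X, ⟨isGrassSolution_of_eq_map (hB ▸ hΦ) (hX₀.trans hm) fun x => rfl,
    tendsto_grass_of_eventually_cone hm (fun x => rfl) hU hV hY
      fun e he => hnarrow.eventually_atBot he⟩, fun X' ⟨hX', hlim⟩ => funext fun x => ?_⟩
  obtain ⟨X₁, hX₁, hmap⟩ := hX'.exists_eq_map (hB ▸ hΦ)
  have hX₁_narrow : S.InNarrowCone Φ X₁ :=
    inNarrowCone_of_tendsto_atBot hΦ (hX₁.trans hm.symm) hmap hV hY hlim
  have hX₁X₀ : X₁ = X₀ := hX₁_narrow.eq hΦ (hX₁.trans hm.symm) hX₀ hnarrow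
  exact Subtype.ext ((hmap x).trans (by rw [hX₁X₀]))

theorem tendsto_atTop_of_tendsto_atBot
    (hB : S.B = fun x => Matrix.toEuclideanCLM (𝕜 := ℂ) (M x)) (hm : Module.finrank ℂ F = m)
    (hL : S.L ≤ 1 / 2) (hV : Tendsto S.V atBot (𝓝 V₀)) (hY : Y.1 = LinearMap.ker V₀.toLinearMap)
    (hU₁ : Tendsto S.U atTop (𝓝 U₁)) (hV₁ : Tendsto S.V atTop (𝓝 V₁))
    (hZ : Z.1 = LinearMap.ker V₁.toLinearMap) (hX : IsGrassSolution M X)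
    (hlim : Tendsto X atBot (𝓝 Y)) : Tendsto X atTop (𝓝 Z) := by
  obtain ⟨Φ, hΦ⟩ := exists_isFundamentalSolution S.continuous_B
  obtain ⟨X₀, hX₀, hmap⟩ := hX.exists_eq_map (hB ▸ hΦ)
  have hnarrow : S.InNarrowCone Φ X₀ :=
    inNarrowCone_of_tendsto_atBot hΦ (hX₀.trans hm.symm) hmap hV hY hlim
  exact tendsto_grass_of_eventually_cone hm hmap hU₁ hV₁ hZ
    fun e he => hnarrow.eventually_atTop hΦ hL he

theorem existsUnique_isGrassSolution_tendsto_atTop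
    (hB : S.B = fun x => Matrix.toEuclideanCLM (𝕜 := ℂ) (M x)) (hm : Module.finrank ℂ G = m)
    (hU : Tendsto S.U atTop (𝓝 U₁)) (hV : Tendsto S.V atTop (𝓝 V₁))
    (hY : Y.1 = LinearMap.ker U₁.toLinearMap) :
    ∃! X : ℝ → Grass ι m, IsGrassSolution M X ∧ Tendsto X atTop (𝓝 Y) := by
  obtain ⟨X, ⟨hX, hlim⟩, huniq⟩ := existsUnique_isGrassSolution_tendsto_atBot (reverse_B hB) hm
    (hV.comp tendsto_neg_atBot_atTop) (hU.comp tendsto_neg_atBot_atTop) hY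
  refine ⟨fun x => X (-x), ⟨by simpa using hX.reverse, hlim.comp tendsto_neg_atTop_atBot⟩,
    fun X' ⟨hX', hlim'⟩ => ?_⟩
  rw [← huniq _ ⟨hX'.reverse, hlim'.comp tendsto_neg_atBot_atTop⟩]
  simp only [neg_neg]

theorem tendsto_atBot_of_tendsto_atTop
    (hB : S.B = fun x => Matrix.toEuclideanCLM (𝕜 := ℂ) (M x)) (hm : Module.finrank ℂ G = m)
    (hL : S.L ≤ 1 / 2) (hU : Tendsto S.U atTop (𝓝 U₁)) (hY : Y.1 = LinearMap.ker U₁.toLinearMap)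
    (hU₀ : Tendsto S.U atBot (𝓝 U₀)) (hV₀ : Tendsto S.V atBot (𝓝 V₀))
    (hZ : Z.1 = LinearMap.ker U₀.toLinearMap) (hX : IsGrassSolution M X)
    (hlim : Tendsto X atTop (𝓝 Y)) : Tendsto X atBot (𝓝 Z) := by
  have hrev := tendsto_atTop_of_tendsto_atBot (reverse_B hB) hm hL
    (hU.comp tendsto_neg_atBot_atTop) hY (hV₀.comp tendsto_neg_atTop_atBot)
    (hU₀.comp tendsto_neg_atTop_atBot) hZ hX.reverse (hlim.comp tendsto_neg_atBot_atTop)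
  simpa [Function.comp_def] using hrev.comp tendsto_neg_atBot_atTop

end SplitSystem

end GrassSolution

section FrameCoordinates

/-- The restriction of a vector of `𝕜^ι` to the coordinates selected by `f`; for `f = Sum.inl` and
`f = Sum.inr` these are the two parts of a vector of `𝕜^(ι ⊕ κ)`. -/
noncomputable def restrictCoords (𝕜 : Type*) {ι κ : Type*} [RCLike 𝕜] [Fintype ι] [Fintype κ]
    (f : κ → ι) : EuclideanSpace 𝕜 ι →L[𝕜] EuclideanSpace 𝕜 κ :=
  LinearMap.toContinuousLinearMap ((WithLp.linearEquiv 2 𝕜 (κ → 𝕜)).symm.toLinearMap ∘ₗ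
    LinearMap.funLeft 𝕜 𝕜 f ∘ₗ (WithLp.linearEquiv 2 𝕜 (ι → 𝕜)).toLinearMap)

section restrictCoords

variable {𝕜 ι κ : Type*} [RCLike 𝕜] [Fintype ι] [Fintype κ]

@[simp]
theorem restrictCoords_apply (f : κ → ι) (ζ : EuclideanSpace 𝕜 ι) (i : κ) :
    restrictCoords 𝕜 f ζ i = ζ (f i) := rfl

theorem norm_restrictCoords_le {f : κ → ι} (hf : Function.Injective f) (ζ : EuclideanSpace 𝕜 ι) :
    ‖restrictCoords 𝕜 f ζ‖ ≤ ‖ζ‖ := by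
  classical
  refine (sq_le_sq₀ (norm_nonneg _) (norm_nonneg _)).1 ?_
  simp only [EuclideanSpace.norm_sq_eq, restrictCoords_apply]
  rw [← Finset.sum_image (f := fun i => ‖ζ i‖ ^ 2) hf.injOn]
  exact Finset.sum_le_univ_sum_of_nonneg fun i => by positivity

theorem norm_le_norm_restrictCoords_add (ζ : EuclideanSpace 𝕜 (ι ⊕ κ)) :
    ‖ζ‖ ≤ ‖restrictCoords 𝕜 Sum.inl ζ‖ + ‖restrictCoords 𝕜 Sum.inr ζ‖ := by
  have hsq : ‖ζ‖ ^ 2 = ‖restrictCoords 𝕜 Sum.inl ζ‖ ^ 2 + ‖restrictCoords 𝕜 Sum.inr ζ‖ ^ 2 := by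
    simp only [EuclideanSpace.norm_sq_eq, Fintype.sum_sum_type, restrictCoords_apply]
  refine (sq_le_sq₀ (norm_nonneg _) (by positivity)).1 ?_
  rw [hsq, add_sq]
  linarith [mul_nonneg (norm_nonneg (restrictCoords 𝕜 Sum.inl ζ))
    (norm_nonneg (restrictCoords 𝕜 Sum.inr ζ))]

variable [DecidableEq ι] [DecidableEq κ] (P : Matrix ι ι 𝕜) (Q : Matrix κ κ 𝕜)

theorem restrictCoords_inl_fromBlocks (ζ : EuclideanSpace 𝕜 (ι ⊕ κ)) :
    restrictCoords 𝕜 Sum.inl (Matrix.toEuclideanCLM (𝕜 := 𝕜) (Matrix.fromBlocks P 0 0 Q) ζ) =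
      Matrix.toEuclideanCLM (𝕜 := 𝕜) P (restrictCoords 𝕜 Sum.inl ζ) := by
  ext i
  simp [Matrix.ofLp_toEuclideanCLM, Matrix.mulVec, dotProduct]

theorem restrictCoords_inr_fromBlocks (ζ : EuclideanSpace 𝕜 (ι ⊕ κ)) :
    restrictCoords 𝕜 Sum.inr (Matrix.toEuclideanCLM (𝕜 := 𝕜) (Matrix.fromBlocks P 0 0 Q) ζ) =
      Matrix.toEuclideanCLM (𝕜 := 𝕜) Q (restrictCoords 𝕜 Sum.inr ζ) := by
  ext i
  simp [Matrix.ofLp_toEuclideanCLM, Matrix.mulVec, dotProduct]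

end restrictCoords

/-- The coefficients, selected by `f`, of a vector in the basis of the columns of `P`. -/
noncomputable def frameCoords {ι κ : Type*} [Fintype ι] [DecidableEq ι] [Fintype κ] (f : κ → ι)
    (P : GL ι ℂ) : EuclideanSpace ℂ ι →L[ℂ] EuclideanSpace ℂ κ :=
  restrictCoords ℂ f ∘L Matrix.toEuclideanCLM (𝕜 := ℂ) (P⁻¹).val

section frameCoords

theorem norm_le_norm_frameCoords {ι κ : Type*} [Fintype ι] [DecidableEq ι] [Fintype κ]
    [DecidableEq κ] (P : GL (ι ⊕ κ) ℂ) (ξ : EuclideanSpace ℂ (ι ⊕ κ)) :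
    ‖ξ‖ ≤ ‖P.val‖ * (‖frameCoords Sum.inl P ξ‖ + ‖frameCoords Sum.inr P ξ‖) := by
  set ζ := Matrix.toEuclideanCLM (𝕜 := ℂ) (P⁻¹).val ξ with hζ
  have hξ : ξ = Matrix.toEuclideanCLM (𝕜 := ℂ) P.val ζ := by
    rw [hζ, ← mul_apply_eq_comp, ← map_mul, Units.mul_inv, map_one, one_apply_eq_self]
  calc ‖ξ‖ ≤ ‖P.val‖ * ‖ζ‖ := by
        rw [hξ, ← Matrix.l2_opNorm_toEuclideanCLM]
        exact ContinuousLinearMap.le_opNorm _ _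
    _ ≤ ‖P.val‖ * (‖frameCoords Sum.inl P ξ‖ + ‖frameCoords Sum.inr P ξ‖) := by
        gcongr
        exact norm_le_norm_restrictCoords_add ζ

theorem frameCoords_colVec {ι κ : Type} [Fintype ι] [DecidableEq ι] [Fintype κ] (f : κ → ι)
    (P : GL ι ℂ) (k : ι) :
    frameCoords f P (colVec P.val k) = restrictCoords ℂ f (EuclideanSpace.single k 1) := by
  have hcol : colVec P.val k =
      Matrix.toEuclideanCLM (𝕜 := ℂ) P.val (EuclideanSpace.single k 1) := by
    change _ = Matrix.toEuclideanCLM (𝕜 := ℂ) P.val (WithLp.toLp 2 (Pi.single k 1))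
    rw [Matrix.toEuclideanCLM_toLp, Matrix.mulVec_single_one]
    rfl
  rw [hcol, frameCoords, ContinuousLinearMap.comp_apply, ← mul_apply_eq_comp, ← map_mul,
    Units.inv_mul, map_one, one_apply_eq_self]

theorem spanCols_le_ker_frameCoords {ι κ : Type} [Fintype ι] [DecidableEq ι] [Fintype κ] {m : ℕ}
    (P : GL ι ℂ) (f : Fin m ↪ ι) {g : κ → ι} (hfg : ∀ i j, f i ≠ g j) :
    (spanCols P f).1 ≤ LinearMap.ker (frameCoords g P).toLinearMap := by
  refine Submodule.span_le.2 ?_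
  rintro _ ⟨i, rfl⟩
  change frameCoords g P (colVec P.val (f i)) = 0
  rw [frameCoords_colVec]
  ext j
  simp [hfg i j]

variable {p q : ℕ}

theorem spanCols_inl_eq_ker (P : GL (Fin p ⊕ Fin q) ℂ) :
    (spanCols P ⟨Sum.inl, Sum.inl_injective⟩).1 =
      LinearMap.ker (frameCoords Sum.inr P).toLinearMap := by
  refine Submodule.eq_of_le_of_finrank_eq
    (spanCols_le_ker_frameCoords P _ fun i j => Sum.inl_ne_inr) ?_
  rw [finrank_ker_of_coordinates (by simp) (norm_le_norm_frameCoords P), (spanCols P _).2,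
    finrank_euclideanSpace_fin]

theorem spanCols_inr_eq_ker (P : GL (Fin p ⊕ Fin q) ℂ) :
    (spanCols P ⟨Sum.inr, Sum.inr_injective⟩).1 =
      LinearMap.ker (frameCoords Sum.inl P).toLinearMap := by
  refine Submodule.eq_of_le_of_finrank_eq
    (spanCols_le_ker_frameCoords P _ fun i j => Sum.inr_ne_inl) ?_
  rw [finrank_ker_of_coordinates (F := EuclideanSpace ℂ (Fin q)) (by simp [add_comm])
    fun ξ => (norm_le_norm_frameCoords P ξ).trans_eq (by rw [add_comm]), (spanCols P _).2,
    finrank_euclideanSpace_fin]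

end frameCoords

end FrameCoordinates

section MovingFrame

variable {ι κ : Type*} [Fintype ι] [DecidableEq ι] [Fintype κ]

/-- The operator `p ∘ M` as a continuous linear function of the matrix `M`. -/
noncomputable def compToEuclideanCLM {F : Type*} [NormedAddCommGroup F] [NormedSpace ℂ F]
    (p : EuclideanSpace ℂ ι →L[ℂ] F) :
    Matrix ι ι ℂ →L[ℂ] (EuclideanSpace ℂ ι →L[ℂ] F) :=
  LinearMap.toContinuousLinearMap
    ((ContinuousLinearMap.compL ℂ _ _ _ p).toLinearMap ∘ₗ
      (Matrix.toEuclideanCLM (𝕜 := ℂ)).toAlgEquiv.toLinearMap)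

theorem continuousOn_inv_val {R : ℝ → GL ι ℂ} {s : Set ℝ}
    (hR : ContinuousOn (fun τ => (R τ).val) s) : ContinuousOn (fun τ => ((R τ)⁻¹).val) s :=
  fun τ hτ => by
    simpa [Function.comp_def] using
      (NormedRing.inverse_continuousAt (R τ)).comp_continuousWithinAt (f := fun τ => (R τ).val)
        (hR τ hτ)

theorem continuousOn_frameCoords (f : κ → ι) {R : ℝ → GL ι ℂ} {s : Set ℝ}
    (hR : ContinuousOn (fun τ => (R τ).val) s) : ContinuousOn (fun τ => frameCoords f (R τ)) s :=
  (compToEuclideanCLM (restrictCoords ℂ f)).continuous.comp_continuousOn (continuousOn_inv_val hR)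

theorem hasDerivAt_frameCoords (f : κ → ι) {R : ℝ → GL ι ℂ} {R' : Matrix ι ι ℂ} {x : ℝ}
    (hR : HasDerivAt (fun x => (R x).val) R' x) :
    HasDerivAt (fun x => frameCoords f (R x)) (restrictCoords ℂ f ∘L
      Matrix.toEuclideanCLM (𝕜 := ℂ) (-(((R x)⁻¹).val * R' * ((R x)⁻¹).val))) x := by
  have hinv : HasDerivAt (fun x => ((R x)⁻¹).val) (-(((R x)⁻¹).val * R' * ((R x)⁻¹).val)) x := by
    simpa [Function.comp_def] using (hasFDerivAt_ringInverse (𝕜 := ℝ) (R x)).comp_hasDerivAt x hR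
  exact ((compToEuclideanCLM (restrictCoords ℂ f)).restrictScalars ℝ).hasFDerivAt.comp_hasDerivAt
    x hinv

end MovingFrame

section HeteroclinicOrbit

/-- `χ` is a solution of `χ' = (1 - χ²) h(χ)` connecting the equilibria `-1` and `1`; only the
restriction of `h` to `[-1, 1]` matters. -/
structure IsHeteroclinicOrbit (h χ : ℝ → ℝ) : Prop where
  continuousOn : ContinuousOn h (Icc (-1) 1)
  pos : ∀ τ ∈ Icc (-1 : ℝ) 1, 0 < h τ
  mem_Ioo : ∀ x, χ x ∈ Ioo (-1 : ℝ) 1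
  hasDerivAt : ∀ x, HasDerivAt χ ((1 - χ x ^ 2) * h (χ x)) x

namespace IsHeteroclinicOrbit

variable {h χ : ℝ → ℝ} {α : Type*} [TopologicalSpace α] {f : ℝ → α}

theorem mem_Icc (hχ : IsHeteroclinicOrbit h χ) (x : ℝ) : χ x ∈ Icc (-1 : ℝ) 1 :=
  Ioo_subset_Icc_self (hχ.mem_Ioo x)

theorem differentiable (hχ : IsHeteroclinicOrbit h χ) : Differentiable ℝ χ :=
  fun x => (hχ.hasDerivAt x).differentiableAt

theorem deriv_eq (hχ : IsHeteroclinicOrbit h χ) :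
    deriv χ = fun x => (1 - χ x ^ 2) * h (χ x) :=
  funext fun x => (hχ.hasDerivAt x).deriv

theorem monotone (hχ : IsHeteroclinicOrbit h χ) : Monotone χ :=
  monotone_of_deriv_nonneg hχ.differentiable fun x => by
    rw [hχ.deriv_eq]
    exact mul_nonneg (by nlinarith [(hχ.mem_Ioo x).1, (hχ.mem_Ioo x).2])
      (hχ.pos _ (hχ.mem_Icc x)).le

theorem reverse (hχ : IsHeteroclinicOrbit h χ) :
    IsHeteroclinicOrbit (fun τ => h (-τ)) (fun x => -χ (-x)) where
  continuousOn := hχ.continuousOn.comp continuousOn_neg fun τ hτ => neg_mem_Icc_iff.2 (by simpa)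
  pos τ hτ := hχ.pos _ (neg_mem_Icc_iff.2 (by simpa))
  mem_Ioo x := neg_mem_Ioo_iff.2 (by simpa using hχ.mem_Ioo (-x))
  hasDerivAt x := by
    simpa [Function.comp_def] using ((hχ.hasDerivAt (-x)).scomp x (hasDerivAt_neg x)).fun_neg

theorem one_sub_le_mul_exp (hχ : IsHeteroclinicOrbit h χ) {h₀ : ℝ}
    (hh : ∀ τ ∈ Icc (-1 : ℝ) 1, h₀ ≤ h τ) {x : ℝ} (hx : 0 ≤ x) :
    1 - χ x ≤ (1 - χ 0) * Real.exp (-(h₀ * (1 + χ 0)) * x) := by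
  have hexp := le_mul_exp_of_deriv_le_mul (c := -(h₀ * (1 + χ 0))) hx
    (fun t _ => (hχ.hasDerivAt t).const_sub 1) fun t ht => ?_
  · rwa [sub_zero] at hexp
  have hrate : h₀ * (1 + χ 0) ≤ (1 + χ t) * h (χ t) := calc
    h₀ * (1 + χ 0) ≤ h (χ t) * (1 + χ t) :=
      mul_le_mul (hh _ (hχ.mem_Icc t)) (by linarith [hχ.monotone ht.1])
        (by linarith [(hχ.mem_Ioo 0).1]) (hχ.pos _ (hχ.mem_Icc t)).le
    _ = (1 + χ t) * h (χ t) := mul_comm _ _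
  linarith [mul_le_mul_of_nonneg_left hrate (sub_nonneg.2 (hχ.mem_Ioo t).2.le)]

theorem tendsto_atTop (hχ : IsHeteroclinicOrbit h χ) : Tendsto χ atTop (𝓝 1) := by
  obtain ⟨τ₀, hτ₀, hmin⟩ := isCompact_Icc.exists_isMinOn
    (nonempty_Icc.2 (by norm_num : (-1 : ℝ) ≤ 1)) hχ.continuousOn
  have hrate : 0 < h τ₀ * (1 + χ 0) :=
    mul_pos (hχ.pos τ₀ hτ₀) (by linarith [(hχ.mem_Ioo 0).1])
  have hexp : Tendsto (fun x => 1 - (1 - χ 0) * Real.exp (-(h τ₀ * (1 + χ 0)) * x)) atTop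
      (𝓝 1) := by
    simpa using ((Real.tendsto_exp_atBot.comp
      (tendsto_id.const_mul_atTop_of_neg (neg_lt_zero.2 hrate))).const_mul (1 - χ 0)).const_sub 1
  refine tendsto_of_tendsto_of_tendsto_of_le_of_le' hexp tendsto_const_nhds ?_
    (Eventually.of_forall fun x => (hχ.mem_Ioo x).2.le)
  filter_upwards [eventually_ge_atTop 0] with x hx
  linarith [hχ.one_sub_le_mul_exp (fun τ hτ => hmin hτ) hx]

theorem tendsto_atBot (hχ : IsHeteroclinicOrbit h χ) : Tendsto χ atBot (𝓝 (-1)) := by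
  simpa [Function.comp_def] using (hχ.reverse.tendsto_atTop.comp tendsto_neg_atBot_atTop).neg

theorem tendsto_atTop_nhdsWithin (hχ : IsHeteroclinicOrbit h χ) :
    Tendsto χ atTop (𝓝[Icc (-1) 1] 1) :=
  tendsto_nhdsWithin_iff.2 ⟨hχ.tendsto_atTop, Eventually.of_forall hχ.mem_Icc⟩

theorem tendsto_atBot_nhdsWithin (hχ : IsHeteroclinicOrbit h χ) :
    Tendsto χ atBot (𝓝[Icc (-1) 1] (-1)) :=
  tendsto_nhdsWithin_iff.2 ⟨hχ.tendsto_atBot, Eventually.of_forall hχ.mem_Icc⟩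

theorem tendsto_comp_atTop (hχ : IsHeteroclinicOrbit h χ) (hf : ContinuousOn f (Icc (-1) 1)) :
    Tendsto (fun x => f (χ x)) atTop (𝓝 (f 1)) :=
  (hf 1 (by norm_num)).tendsto.comp hχ.tendsto_atTop_nhdsWithin

theorem tendsto_comp_atBot (hχ : IsHeteroclinicOrbit h χ) (hf : ContinuousOn f (Icc (-1) 1)) :
    Tendsto (fun x => f (χ x)) atBot (𝓝 (f (-1))) :=
  (hf (-1) (by norm_num)).tendsto.comp hχ.tendsto_atBot_nhdsWithin

theorem continuousOn_vectorField (hχ : IsHeteroclinicOrbit h χ) :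
    ContinuousOn (fun τ => (1 - τ ^ 2) * h τ) (Icc (-1) 1) :=
  ContinuousOn.mul (by fun_prop) hχ.continuousOn

theorem tendsto_deriv_atTop (hχ : IsHeteroclinicOrbit h χ) : Tendsto (deriv χ) atTop (𝓝 0) := by
  simpa [hχ.deriv_eq] using hχ.tendsto_comp_atTop hχ.continuousOn_vectorField

theorem tendsto_deriv_atBot (hχ : IsHeteroclinicOrbit h χ) : Tendsto (deriv χ) atBot (𝓝 0) := by
  simpa [hχ.deriv_eq] using hχ.tendsto_comp_atBot hχ.continuousOn_vectorField

end IsHeteroclinicOrbit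

end HeteroclinicOrbit

section NumericalRange

variable {F G : Type*} [NormedAddCommGroup F] [InnerProductSpace ℂ F]
  [NormedAddCommGroup G] [InnerProductSpace ℂ G]

/-- The real parts of the numerical ranges of `S` and `T` are bounded below by `a` and above by `b`,
respectively. -/
def NumericalRangeBounds (S : F →L[ℂ] F) (T : G →L[ℂ] G) (a b : ℝ) : Prop :=
  (∀ u : F, a * ‖u‖ ^ 2 ≤ (inner ℂ u (S u)).re) ∧ ∀ v : G, (inner ℂ v (T v)).re ≤ b * ‖v‖ ^ 2

theorem abs_re_inner_le (u w : F) : |(inner ℂ u w).re| ≤ ‖u‖ * ‖w‖ :=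
  (Complex.abs_re_le_norm _).trans (norm_inner_le_norm u w)

theorem abs_re_inner_apply_sub_le (S S' : F →L[ℂ] F) (u : F) :
    |(inner ℂ u (S u)).re - (inner ℂ u (S' u)).re| ≤ ‖S - S'‖ * ‖u‖ ^ 2 := calc
  |(inner ℂ u (S u)).re - (inner ℂ u (S' u)).re| = |(inner ℂ u ((S - S') u)).re| := by
    rw [sub_apply, inner_sub_right, Complex.sub_re]
  _ ≤ ‖u‖ * (‖S - S'‖ * ‖u‖) :=
    (abs_re_inner_le u _).trans (by gcongr; exact (S - S').le_opNorm u)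
  _ = ‖S - S'‖ * ‖u‖ ^ 2 := by ring

theorem NumericalRangeBounds.eventually {α : Type*} {l : Filter α} {S : α → F →L[ℂ] F}
    {T : α → G →L[ℂ] G} {S₀ : F →L[ℂ] F} {T₀ : G →L[ℂ] G} {a b δ : ℝ}
    (h : NumericalRangeBounds S₀ T₀ a b) (hδ : 0 < δ) (hS : Tendsto S l (𝓝 S₀))
    (hT : Tendsto T l (𝓝 T₀)) :
    ∀ᶠ x in l, NumericalRangeBounds (S x) (T x) (a - δ) (b + δ) := by
  filter_upwards [(tendsto_iff_norm_sub_tendsto_zero.1 hS).eventually_le_const hδ,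
    (tendsto_iff_norm_sub_tendsto_zero.1 hT).eventually_le_const hδ] with x hSx hTx
  refine ⟨fun u => ?_, fun v => ?_⟩
  · linarith [h.1 u, (abs_le.1 (abs_re_inner_apply_sub_le (S x) S₀ u)).1,
      mul_le_mul_of_nonneg_right hSx (sq_nonneg ‖u‖)]
  · linarith [h.2 v, (abs_le.1 (abs_re_inner_apply_sub_le (T x) T₀ v)).2,
      mul_le_mul_of_nonneg_right hTx (sq_nonneg ‖v‖)]

theorem NumericalRangeBounds.separatedGrowth {S : F →L[ℂ] F} {T : G →L[ℂ] G} {a b ε : ℝ}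
    (h : NumericalRangeBounds S T a b) {u w : F} {v z : G} (hw : ‖w‖ ≤ ε * (‖u‖ + ‖v‖))
    (hz : ‖z‖ ≤ ε * (‖u‖ + ‖v‖)) : SeparatedGrowth u (w + S u) v (z + T v) ε a b := by
  have huw : |(inner ℂ u w).re| ≤ ‖u‖ * (ε * (‖u‖ + ‖v‖)) :=
    (abs_re_inner_le u w).trans (by gcongr)
  have hvz : |(inner ℂ v z).re| ≤ ‖v‖ * (ε * (‖u‖ + ‖v‖)) :=
    (abs_re_inner_le v z).trans (by gcongr)
  simp only [SeparatedGrowth, inner_add_right, Complex.add_re]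
  constructor
  · linarith [h.1 u, (abs_le.1 huw).1]
  · linarith [h.2 v, (abs_le.1 hvz).2]

end NumericalRange

section BlockDiagonal

variable {ι κ : Type*} [Fintype ι] [DecidableEq ι] [Fintype κ] [DecidableEq κ]

theorem frameCoords_inl_apply {A : Matrix (ι ⊕ κ) (ι ⊕ κ) ℂ} {R : GL (ι ⊕ κ) ℂ} {P : Matrix ι ι ℂ}
    {Q : Matrix κ κ ℂ} (hblock : (R⁻¹).val * A * R.val = Matrix.fromBlocks P 0 0 Q)
    (ξ : EuclideanSpace ℂ (ι ⊕ κ)) :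
    frameCoords Sum.inl R (Matrix.toEuclideanCLM (𝕜 := ℂ) A ξ) =
      Matrix.toEuclideanCLM (𝕜 := ℂ) P (frameCoords Sum.inl R ξ) := by
  have hA : (R⁻¹).val * A = Matrix.fromBlocks P 0 0 Q * (R⁻¹).val := by
    rw [← hblock, mul_assoc, Units.mul_inv, mul_one]
  simp only [frameCoords, ContinuousLinearMap.comp_apply]
  rw [← restrictCoords_inl_fromBlocks P Q, ← mul_apply_eq_comp, ← mul_apply_eq_comp, ← map_mul,
    ← map_mul, hA]

theorem frameCoords_inr_apply {A : Matrix (ι ⊕ κ) (ι ⊕ κ) ℂ} {R : GL (ι ⊕ κ) ℂ} {P : Matrix ι ι ℂ}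
    {Q : Matrix κ κ ℂ} (hblock : (R⁻¹).val * A * R.val = Matrix.fromBlocks P 0 0 Q)
    (ξ : EuclideanSpace ℂ (ι ⊕ κ)) :
    frameCoords Sum.inr R (Matrix.toEuclideanCLM (𝕜 := ℂ) A ξ) =
      Matrix.toEuclideanCLM (𝕜 := ℂ) Q (frameCoords Sum.inr R ξ) := by
  have hA : (R⁻¹).val * A = Matrix.fromBlocks P 0 0 Q * (R⁻¹).val := by
    rw [← hblock, mul_assoc, Units.mul_inv, mul_one]
  simp only [frameCoords, ContinuousLinearMap.comp_apply]
  rw [← restrictCoords_inr_fromBlocks P Q, ← mul_apply_eq_comp, ← mul_apply_eq_comp, ← map_mul,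
    ← map_mul, hA]

theorem norm_deriv_frameCoords_apply_le {ν : Type*} [Fintype ν] {f : ν → ι ⊕ κ}
    (hf : Function.Injective f) {R : ℝ → GL (ι ⊕ κ) ℂ} {R' : Matrix (ι ⊕ κ) (ι ⊕ κ) ℂ} {x : ℝ}
    (hR : HasDerivAt (fun x => (R x).val) R' x) (ξ : EuclideanSpace ℂ (ι ⊕ κ)) :
    ‖deriv (fun x => frameCoords f (R x)) x ξ‖ ≤ ‖((R x)⁻¹).val * R'‖ *
      (‖frameCoords Sum.inl (R x) ξ‖ + ‖frameCoords Sum.inr (R x) ξ‖) := by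
  set ζ := Matrix.toEuclideanCLM (𝕜 := ℂ) ((R x)⁻¹).val ξ
  have hderiv : deriv (fun x => frameCoords f (R x)) x ξ =
      restrictCoords ℂ f (-Matrix.toEuclideanCLM (𝕜 := ℂ) (((R x)⁻¹).val * R') ζ) := by
    rw [(hasDerivAt_frameCoords f hR).deriv, map_neg, map_mul _ (_ * _)]
    rfl
  calc ‖deriv (fun x => frameCoords f (R x)) x ξ‖
      ≤ ‖Matrix.toEuclideanCLM (𝕜 := ℂ) (((R x)⁻¹).val * R') ζ‖ := by
        rw [hderiv, ← norm_neg (Matrix.toEuclideanCLM (𝕜 := ℂ) (((R x)⁻¹).val * R') ζ)]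
        exact norm_restrictCoords_le hf _
    _ ≤ ‖((R x)⁻¹).val * R'‖ * ‖ζ‖ := by
        rw [← Matrix.l2_opNorm_toEuclideanCLM]
        exact ContinuousLinearMap.le_opNorm _ _
    _ ≤ _ := by
        gcongr
        exact norm_le_norm_restrictCoords_add ζ

theorem NumericalRangeBounds.separatedGrowthAt_frameCoords {A R' : Matrix (ι ⊕ κ) (ι ⊕ κ) ℂ}
    {R : ℝ → GL (ι ⊕ κ) ℂ} {P : Matrix ι ι ℂ} {Q : Matrix κ κ ℂ} {B : ℝ → _} {x a b ε : ℝ}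
    (h : NumericalRangeBounds (Matrix.toEuclideanCLM (𝕜 := ℂ) P)
      (Matrix.toEuclideanCLM (𝕜 := ℂ) Q) a b)
    (hB : B x = Matrix.toEuclideanCLM (𝕜 := ℂ) A)
    (hblock : ((R x)⁻¹).val * A * (R x).val = Matrix.fromBlocks P 0 0 Q)
    (hR : HasDerivAt (fun x => (R x).val) R' x) (hε : ‖((R x)⁻¹).val * R'‖ ≤ ε) :
    SeparatedGrowthAt B (fun x => frameCoords Sum.inl (R x)) (fun x => frameCoords Sum.inr (R x))
      x ε a b := by
  intro ξ
  rw [hB, frameCoords_inl_apply hblock, frameCoords_inr_apply hblock]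
  exact h.separatedGrowth
    ((norm_deriv_frameCoords_apply_le Sum.inl_injective hR ξ).trans (by gcongr))
    ((norm_deriv_frameCoords_apply_le Sum.inr_injective hR ξ).trans (by gcongr))

end BlockDiagonal

section BlockSplitting

variable {ι κ : Type*} [Fintype ι] [DecidableEq ι] [Fintype κ] [DecidableEq κ]

/-- The columns of `R` bring `A` on `[-1, 1]` into the block-diagonal form `diag(P, Q)`, the
numerical range of `P` lying strictly to the right of that of `Q` at every point. -/
structure BlockSplitting (A : ℝ → Matrix (ι ⊕ κ) (ι ⊕ κ) ℂ) (R : ℝ → GL (ι ⊕ κ) ℂ)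
    (P : ℝ → Matrix ι ι ℂ) (Q : ℝ → Matrix κ κ ℂ) : Prop where
  continuousOn_A : ContinuousOn A (Icc (-1) 1)
  contDiffOn_R : ContDiffOn ℝ 1 (fun τ => (R τ).val) (Icc (-1) 1)
  block : ∀ τ ∈ Icc (-1 : ℝ) 1,
    ((R τ)⁻¹).val * A τ * (R τ).val = Matrix.fromBlocks (P τ) 0 0 (Q τ)
  separated : ∀ τ ∈ Icc (-1 : ℝ) 1, ∃ a b, b < a ∧ NumericalRangeBounds
    (Matrix.toEuclideanCLM (𝕜 := ℂ) (P τ)) (Matrix.toEuclideanCLM (𝕜 := ℂ) (Q τ)) a b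

theorem continuous_toEuclideanCLM :
    Continuous (Matrix.toEuclideanCLM (n := ι) (𝕜 := ℂ)) :=
  (AddMonoidHomClass.isometry_of_norm _ Matrix.l2_opNorm_toEuclideanCLM).continuous

namespace BlockSplitting

variable {A : ℝ → Matrix (ι ⊕ κ) (ι ⊕ κ) ℂ} {R : ℝ → GL (ι ⊕ κ) ℂ} {P : ℝ → Matrix ι ι ℂ}
  {Q : ℝ → Matrix κ κ ℂ} {h χ : ℝ → ℝ} {k : ℝ}

theorem continuousOn_R (D : BlockSplitting A R P Q) :
    ContinuousOn (fun τ => (R τ).val) (Icc (-1) 1) :=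
  D.contDiffOn_R.continuousOn

theorem continuousOn_fromBlocks (D : BlockSplitting A R P Q) :
    ContinuousOn (fun τ => Matrix.fromBlocks (P τ) 0 0 (Q τ)) (Icc (-1) 1) :=
  (((continuousOn_inv_val D.continuousOn_R).mul D.continuousOn_A).mul D.continuousOn_R).congr
    fun τ hτ => (D.block τ hτ).symm

theorem continuousOn_P (D : BlockSplitting A R P Q) : ContinuousOn P (Icc (-1) 1) :=
  (continuous_id.matrix_submatrix Sum.inl Sum.inl).comp_continuousOn D.continuousOn_fromBlocks

theorem continuousOn_Q (D : BlockSplitting A R P Q) : ContinuousOn Q (Icc (-1) 1) :=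
  (continuous_id.matrix_submatrix Sum.inr Sum.inr).comp_continuousOn D.continuousOn_fromBlocks

theorem hasDerivWithinAt_R (D : BlockSplitting A R P Q) {τ : ℝ} (hτ : τ ∈ Icc (-1 : ℝ) 1) :
    HasDerivWithinAt (fun s => (R s).val) (derivWithin (fun s => (R s).val) (Icc (-1) 1) τ)
      (Icc (-1) 1) τ :=
  (D.contDiffOn_R.differentiableOn one_ne_zero τ hτ).hasDerivWithinAt

theorem hasDerivAt_R_comp (D : BlockSplitting A R P Q) (hχ : IsHeteroclinicOrbit h χ) (x : ℝ) :
    HasDerivAt (fun x => (R (χ x)).val)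
      (deriv χ x • derivWithin (fun s => (R s).val) (Icc (-1) 1) (χ x)) x :=
  ((D.hasDerivWithinAt_R (hχ.mem_Icc x)).hasDerivAt
    (Icc_mem_nhds (hχ.mem_Ioo x).1 (hχ.mem_Ioo x).2)).scomp x (hχ.differentiable x).hasDerivAt

theorem differentiable_frameCoords_comp (D : BlockSplitting A R P Q) (hχ : IsHeteroclinicOrbit h χ)
    {ν : Type*} [Fintype ν] (f : ν → ι ⊕ κ) :
    Differentiable ℝ fun x => frameCoords f (R (χ x)) := fun x =>
  (hasDerivAt_frameCoords (R := fun x => R (χ x)) f (D.hasDerivAt_R_comp hχ x)).differentiableAt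

theorem exists_norm_R_le (D : BlockSplitting A R P Q) :
    ∃ C, ∀ τ ∈ Icc (-1 : ℝ) 1, ‖(R τ).val‖ ≤ C :=
  isCompact_Icc.exists_bound_of_continuousOn D.continuousOn_R

theorem exists_norm_inv_mul_derivWithin_le (D : BlockSplitting A R P Q) :
    ∃ k > 0, ∀ τ ∈ Icc (-1 : ℝ) 1,
      ‖((R τ)⁻¹).val * derivWithin (fun s => (R s).val) (Icc (-1) 1) τ‖ ≤ k := by
  obtain ⟨k, hk⟩ := isCompact_Icc.exists_bound_of_continuousOn
    ((continuousOn_inv_val D.continuousOn_R).mul (D.contDiffOn_R.continuousOn_derivWithin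
      (uniqueDiffOn_Icc (by norm_num)) le_rfl))
  exact ⟨max k 1, by positivity, fun τ hτ => (hk τ hτ).trans (le_max_left k 1)⟩

/- By the mean value inequality `‖R(0)⁻¹ R(τ) - 1‖ ≤ c`, and a Neumann series argument replaces
`R(0)⁻¹` by `R(τ)⁻¹` at the cost of the factor `1 / (1 - c)`. -/
theorem norm_inv_mul_derivWithin_le (D : BlockSplitting A R P Q) {c : ℝ} (hc₁ : c < 1)
    (hc : ∀ τ ∈ Icc (-1 : ℝ) 1,
      ‖((R 0)⁻¹).val * derivWithin (fun s => (R s).val) (Icc (-1) 1) τ‖ ≤ c)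
    {τ : ℝ} (hτ : τ ∈ Icc (-1 : ℝ) 1) :
    ‖((R τ)⁻¹).val * derivWithin (fun s => (R s).val) (Icc (-1) 1) τ‖ ≤ c / (1 - c) := by
  have hc₀ : 0 ≤ c := (norm_nonneg _).trans (hc τ hτ)
  have hdist : ‖((R 0)⁻¹).val * (R τ).val - 1‖ ≤ c := by
    have hmean := (convex_Icc (-1 : ℝ) 1).norm_image_sub_le_of_norm_hasDerivWithin_le
      (fun s hs => (D.hasDerivWithinAt_R hs).const_mul ((R 0)⁻¹).val) hc
      (show (0 : ℝ) ∈ Icc (-1 : ℝ) 1 by norm_num) hτ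
    rw [Units.inv_mul, sub_zero] at hmean
    exact hmean.trans (mul_le_of_le_one_right hc₀ (abs_le.2 hτ))
  set R' := derivWithin (fun s => (R s).val) (Icc (-1) 1) τ
  have hsplit : ((R τ)⁻¹).val * R' =
      ((R 0)⁻¹).val * R' - (((R 0)⁻¹).val * (R τ).val - 1) * (((R τ)⁻¹).val * R') := by
    rw [sub_mul, one_mul, mul_assoc ((R 0)⁻¹).val, ← mul_assoc (R τ).val, Units.mul_inv,
      one_mul, sub_sub_cancel]
  have hbound : ‖((R τ)⁻¹).val * R'‖ ≤ c + c * ‖((R τ)⁻¹).val * R'‖ := calc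
    ‖((R τ)⁻¹).val * R'‖
        ≤ ‖((R 0)⁻¹).val * R'‖ + ‖((R 0)⁻¹).val * (R τ).val - 1‖ * ‖((R τ)⁻¹).val * R'‖ := by
      conv_lhs => rw [hsplit]
      exact (norm_sub_le _ _).trans (by gcongr; exact norm_mul_le _ _)
    _ ≤ c + c * ‖((R τ)⁻¹).val * R'‖ := by
      gcongr
      exact hc τ hτ
  rw [le_div_iff₀ (sub_pos.2 hc₁)]
  linarith

theorem exists_eventually_numericalRangeBounds (D : BlockSplitting A R P Q) {l : Filter ℝ} {σ : ℝ}
    (hσ : σ ∈ Icc (-1 : ℝ) 1) (hχ : Tendsto χ l (𝓝[Icc (-1) 1] σ)) :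
    ∃ a b, b < a ∧ ∀ᶠ x in l,
      NumericalRangeBounds (Matrix.toEuclideanCLM (𝕜 := ℂ) (P (χ x)))
        (Matrix.toEuclideanCLM (𝕜 := ℂ) (Q (χ x))) a b := by
  obtain ⟨a, b, hab, hσ_bounds⟩ := D.separated σ hσ
  refine ⟨a - (a - b) / 4, b + (a - b) / 4, by linarith,
    hσ_bounds.eventually (by linarith) ?_ ?_⟩
  · exact (continuous_toEuclideanCLM.comp_continuousOn D.continuousOn_P σ hσ).tendsto.comp hχ
  · exact (continuous_toEuclideanCLM.comp_continuousOn D.continuousOn_Q σ hσ).tendsto.comp hχ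

theorem separatedGrowthAt (D : BlockSplitting A R P Q) (hχ : IsHeteroclinicOrbit h χ)
    (hk : ∀ τ ∈ Icc (-1 : ℝ) 1,
      ‖((R τ)⁻¹).val * derivWithin (fun s => (R s).val) (Icc (-1) 1) τ‖ ≤ k) {x a b : ℝ}
    (hx : NumericalRangeBounds (Matrix.toEuclideanCLM (𝕜 := ℂ) (P (χ x)))
      (Matrix.toEuclideanCLM (𝕜 := ℂ) (Q (χ x))) a b) :
    SeparatedGrowthAt (fun x => Matrix.toEuclideanCLM (𝕜 := ℂ) (A (χ x)))
      (fun x => frameCoords Sum.inl (R (χ x))) (fun x => frameCoords Sum.inr (R (χ x))) x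
      (deriv (fun x => k * (χ x + 1)) x) a b := by
  refine hx.separatedGrowthAt_frameCoords (R := fun x => R (χ x)) rfl (D.block _ (hχ.mem_Icc x))
    (D.hasDerivAt_R_comp hχ x) ?_
  rw [mul_smul_comm, norm_smul, deriv_const_mul_field, deriv_add_const, mul_comm k,
    Real.norm_of_nonneg hχ.monotone.deriv_nonneg]
  exact mul_le_mul_of_nonneg_left (hk _ (hχ.mem_Icc x)) hχ.monotone.deriv_nonneg

/-- The system `ξ' = A(χ) ξ` in the coordinates given by the columns of `R(χ)`, with accumulated
coupling `k (χ + 1)` for a bound `k` of `R⁻¹ R'`. -/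
noncomputable def splitSystem (D : BlockSplitting A R P Q) (hχ : IsHeteroclinicOrbit h χ)
    (hk₀ : 0 < k) (hk : ∀ τ ∈ Icc (-1 : ℝ) 1,
      ‖((R τ)⁻¹).val * derivWithin (fun s => (R s).val) (Icc (-1) 1) τ‖ ≤ k) :
    SplitSystem (EuclideanSpace ℂ (ι ⊕ κ)) (EuclideanSpace ℂ ι) (EuclideanSpace ℂ κ) where
  B x := Matrix.toEuclideanCLM (𝕜 := ℂ) (A (χ x))
  U x := frameCoords Sum.inl (R (χ x))
  V x := frameCoords Sum.inr (R (χ x))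
  θ x := k * (χ x + 1)
  L := k * 2
  finrank_eq := by simp
  continuous_B := continuous_toEuclideanCLM.comp
    (D.continuousOn_A.comp_continuous hχ.differentiable.continuous hχ.mem_Icc)
  differentiable_U := D.differentiable_frameCoords_comp hχ _
  differentiable_V := D.differentiable_frameCoords_comp hχ _
  exists_norm_le := by
    obtain ⟨C, hC⟩ := D.exists_norm_R_le
    exact ⟨C, fun x ξ => (norm_le_norm_frameCoords (R (χ x)) ξ).trans
      (by gcongr; exact hC _ (hχ.mem_Icc x))⟩
  differentiable_θ := (hχ.differentiable.add_const 1).const_mul k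
  monotone_θ := (hχ.monotone.add_const 1).const_mul hk₀.le
  θ_mem x := ⟨mul_pos hk₀ (by linarith [(hχ.mem_Ioo x).1]),
    mul_lt_mul_of_pos_left (by linarith [(hχ.mem_Ioo x).2]) hk₀⟩
  tendsto_θ_atBot := by simpa using (hχ.tendsto_atBot.add_const 1).const_mul k
  tendsto_θ_atTop := by
    simpa [one_add_one_eq_two] using (hχ.tendsto_atTop.add_const 1).const_mul k
  tendsto_deriv_θ_atBot := by simpa using hχ.tendsto_deriv_atBot.const_mul k
  tendsto_deriv_θ_atTop := by simpa using hχ.tendsto_deriv_atTop.const_mul k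
  growth x := by
    obtain ⟨a, b, hab, hx⟩ := D.separated _ (hχ.mem_Icc x)
    exact ⟨a, b, hab, D.separatedGrowthAt hχ hk hx⟩
  growth_atBot := by
    obtain ⟨a, b, hab, hx⟩ :=
      D.exists_eventually_numericalRangeBounds (by norm_num) hχ.tendsto_atBot_nhdsWithin
    exact ⟨a, b, hab, hx.mono fun x hx => D.separatedGrowthAt hχ hk hx⟩
  growth_atTop := by
    obtain ⟨a, b, hab, hx⟩ :=
      D.exists_eventually_numericalRangeBounds (by norm_num) hχ.tendsto_atTop_nhdsWithin
    exact ⟨a, b, hab, hx.mono fun x hx => D.separatedGrowthAt hχ hk hx⟩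

end BlockSplitting

end BlockSplitting

theorem mainTheorem5_general {p q : ℕ} {A : ℝ → Matrix (Fin p ⊕ Fin q) (Fin p ⊕ Fin q) ℂ}
    {R : ℝ → GL (Fin p ⊕ Fin q) ℂ} {P : ℝ → Matrix (Fin p) (Fin p) ℂ}
    {Q : ℝ → Matrix (Fin q) (Fin q) ℂ} {h χ : ℝ → ℝ} (D : BlockSplitting A R P Q)
    (hχ : IsHeteroclinicOrbit h χ) :
    (∃! X : ℝ → Grass (Fin p ⊕ Fin q) p, IsGrassSolution (fun x => A (χ x)) X ∧
      Tendsto X atBot (𝓝 (spanCols (R (-1)) ⟨Sum.inl, Sum.inl_injective⟩))) ∧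
    (∃! X : ℝ → Grass (Fin p ⊕ Fin q) q, IsGrassSolution (fun x => A (χ x)) X ∧
      Tendsto X atTop (𝓝 (spanCols (R 1) ⟨Sum.inr, Sum.inr_injective⟩))) ∧
    ((∀ τ ∈ Icc (-1 : ℝ) 1,
        ‖((R 0)⁻¹).val * derivWithin (fun s => (R s).val) (Icc (-1) 1) τ‖ ≤ 1 / 5) →
      (∀ X : ℝ → Grass (Fin p ⊕ Fin q) p, IsGrassSolution (fun x => A (χ x)) X →
        Tendsto X atBot (𝓝 (spanCols (R (-1)) ⟨Sum.inl, Sum.inl_injective⟩)) →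
        Tendsto X atTop (𝓝 (spanCols (R 1) ⟨Sum.inl, Sum.inl_injective⟩))) ∧
      (∀ X : ℝ → Grass (Fin p ⊕ Fin q) q, IsGrassSolution (fun x => A (χ x)) X →
        Tendsto X atTop (𝓝 (spanCols (R 1) ⟨Sum.inr, Sum.inr_injective⟩)) →
        Tendsto X atBot (𝓝 (spanCols (R (-1)) ⟨Sum.inr, Sum.inr_injective⟩)))) := by
  have hU := continuousOn_frameCoords Sum.inl D.continuousOn_R
  have hV := continuousOn_frameCoords Sum.inr D.continuousOn_R
  obtain ⟨k, hk₀, hk⟩ := D.exists_norm_inv_mul_derivWithin_le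
  refine ⟨?_, ?_, fun hc => ?_⟩
  · exact SplitSystem.existsUnique_isGrassSolution_tendsto_atBot (S := D.splitSystem hχ hk₀ hk) rfl
      finrank_euclideanSpace_fin (hχ.tendsto_comp_atBot hU) (hχ.tendsto_comp_atBot hV)
      (spanCols_inl_eq_ker _)
  · exact SplitSystem.existsUnique_isGrassSolution_tendsto_atTop (S := D.splitSystem hχ hk₀ hk) rfl
      finrank_euclideanSpace_fin (hχ.tendsto_comp_atTop hU) (hχ.tendsto_comp_atTop hV)
      (spanCols_inr_eq_ker _)
  have hk : ∀ τ ∈ Icc (-1 : ℝ) 1,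
      ‖((R τ)⁻¹).val * derivWithin (fun s => (R s).val) (Icc (-1) 1) τ‖ ≤ 1 / 4 := fun τ hτ =>
    (D.norm_inv_mul_derivWithin_le (by norm_num) hc hτ).trans_eq (by norm_num)
  let S := D.splitSystem hχ (by norm_num) hk
  have hL : S.L ≤ 1 / 2 := by norm_num [S, BlockSplitting.splitSystem]
  exact ⟨fun X => SplitSystem.tendsto_atTop_of_tendsto_atBot (S := S) rfl
      finrank_euclideanSpace_fin hL (hχ.tendsto_comp_atBot hV) (spanCols_inl_eq_ker _)
      (hχ.tendsto_comp_atTop hU) (hχ.tendsto_comp_atTop hV) (spanCols_inl_eq_ker _),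
    fun X => SplitSystem.tendsto_atBot_of_tendsto_atTop (S := S) rfl
      finrank_euclideanSpace_fin hL (hχ.tendsto_comp_atTop hU) (spanCols_inr_eq_ker _)
      (hχ.tendsto_comp_atBot hU) (hχ.tendsto_comp_atBot hV) (spanCols_inr_eq_ker _)⟩

theorem BlockData.blockSplitting {n : ℕ} {cgt clt : ℝ → ℝ} {A R : ℝ → GL (Fin n ⊕ Fin n) ℂ}
    {Agt Alt : ℝ → Matrix (Fin n) (Fin n) ℂ} (D : BlockData cgt clt A R Agt Alt) :
    BlockSplitting (fun τ => (A τ).val) R Agt Alt where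
  continuousOn_A := D.smooth_A.continuousOn
  contDiffOn_R := D.smooth_R.of_le (by simp)
  block τ hτ := by simpa only [Units.val_mul] using D.block τ hτ
  separated τ hτ := ⟨cgt τ, -clt τ, by linarith [D.pos τ hτ], D.gt τ hτ, D.lt τ hτ⟩

theorem mainTheorem5 (n : ℕ) :
    ∃ c : ℝ, 0 < c ∧
      ∀ (cgt clt : ℝ → ℝ) (A R : ℝ → GL (Fin n ⊕ Fin n) ℂ)
        (Agt Alt : ℝ → Matrix (Fin n) (Fin n) ℂ) (h χ : ℝ → ℝ),
        BlockData cgt clt A R Agt Alt →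
        ContDiffOn ℝ ∞ h (Icc (-1) 1) →
        (∀ τ ∈ Icc (-1 : ℝ) 1, 0 < h τ) →
        (∀ x, χ x ∈ Ioo (-1 : ℝ) 1) →
        (∀ x, HasDerivAt χ ((1 - χ x ^ 2) * h (χ x)) x) →
        χ 0 = 0 →
        (∃! X : ℝ → Grass (Fin n ⊕ Fin n) n,
          IsGrassSolution (fun x => (A (χ x)).val) X ∧
            Tendsto X atBot (𝓝 (spanFirst (R (-1))))) ∧
        (∃! X : ℝ → Grass (Fin n ⊕ Fin n) n,
          IsGrassSolution (fun x => (A (χ x)).val) X ∧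
            Tendsto X atTop (𝓝 (spanLast (R 1)))) ∧
        ((∀ τ ∈ Icc (-1 : ℝ) 1,
            ‖((R 0)⁻¹).val * derivWithin (fun s => (R s).val) (Icc (-1) 1) τ‖ ≤ c) →
          (∀ X : ℝ → Grass (Fin n ⊕ Fin n) n,
            IsGrassSolution (fun x => (A (χ x)).val) X →
            Tendsto X atBot (𝓝 (spanFirst (R (-1)))) →
            Tendsto X atTop (𝓝 (spanFirst (R 1)))) ∧
          (∀ X : ℝ → Grass (Fin n ⊕ Fin n) n,
            IsGrassSolution (fun x => (A (χ x)).val) X →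
            Tendsto X atTop (𝓝 (spanLast (R 1))) →
            Tendsto X atBot (𝓝 (spanLast (R (-1)))))) := by
  refine ⟨1 / 5, by norm_num, fun cgt clt A R Agt Alt h χ D hh hpos hχ hχ' _ => ?_⟩
  obtain ⟨hminus, hplus, hlimits⟩ :=
    mainTheorem5_general D.blockSplitting ⟨hh.continuousOn, hpos, hχ, hχ'⟩
  exact ⟨hminus, hplus, fun hc => hlimits hc⟩
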